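/- **Theorem (Matrix-vector maintenance).** Consider the randomized real RAM: finite programs with loops and branching, not depending on the input, acting on arrays of natural numbers and arrays of real numbers with indirect addressing, in which arithmetic operations ($+,-,\times$ on naturals, $+,-,\times,/$ on reals, no rounding), comparisons and memory accesses take unit time, and in which one can preprocess the first $m$ entries of an array of reals $v$ in $m+1$ time so that afterwards an index $i$ can be sampled with probability proportional to $|v_i|$, independently of the past, in unit time. For both $p=1$ and $p=2$ there are a constant $C>0$ and two programs $\mathtt{init}$ and $\mathtt{query}$ such that the following holds for all integers $n,d\ge 1$, $T\ge 0$, all $A\in\mathbb{R}^{n\times d}$ with $\|A\|_{p\to\infty}=\sup_{\|v\|_p=1}\|Av\|_\infty\le 1$, all $x_0\in\mathbb{R}^d$, all $R,\epsilon$ with $0<\epsilon\le R/2$, all $\delta\in(0,1]$, and all $\Delta_0,\dots,\Delta_{T-1}\in\mathbb{R}^d$ with $\sum_{t<T}\|\Delta_t\|_p\le R$ that are fixed in advance (oblivious adversary). Write $x_{t+1}=x_t+\Delta_t$. Run $\mathtt{init}$ on $(A,x_0,R,\epsilon,\delta)$, with $A$ given as the list of its nonzero entries, and then run $\mathtt{query}$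 on $\Delta_0,\dots,\Delta_{T-1}$, one after the other, each given as the list of its nonzero coordinates and revealed only when the previous query has ended. Let $y_t\in\mathbb{R}^n$ be the content of a designated output array after the $t$-th query; it stays in the memory, so only coordinates that change have to be written. Then 1. with probability at least $1-\delta$, $\|y_t-Ax_t\|_\infty\le\epsilon$ for all $t\in\{1,\dots,T\}$; 2. in every run, the total time of $\mathtt{init}$ and the $T$ queries is at most $$C\left(\sum_{t<T}\mathrm{nnz}(\Delta_t)+\left(\mathrm{nnz}(A)\log^{p-1}\left(\frac{R}{\epsilon}\right)+d\cdot\frac{R}{\epsilon}\right)\log^{p-1}\left(\frac{nR}{\epsilon\delta}\right)+n\left(\frac{R}{\epsilon}\right)^2\log\left(\frac{nR}{\epsilon\delta}\right)\right).$$ Here $\mathrm{nnz}(A)$ is the number of nonzero entries of $A$, and $\mathrm{nnz}(\Delta_t)$ is the number of nonzero coordinates of $\Delta_t$, counted as $1$ if $\Delta_t=0$. -/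

import Mathlib

open scoped ENNReal

namespace RealRAM

/-! ### A randomized real RAM

The memory consists of arrays of natural numbers (used for sizes, counters and addresses) and arrays
of real numbers. A program is a finite piece of code in a structured language. It names finitely
many arrays, does not depend on the input, and may use only rational constants. One time unit pays
for one command: the arithmetic inside a command is a fixed expression of the code, so it has a
constant number of operations `+, -, *, /`, comparisons and memory accesses. There is no rounding
(`floor`) operation. Scalars are cells of arrays, e.g. cell `0`. -/

/-- Expressions for natural numbers: a constant, the content of cell `i` of an array of naturals,
sum, truncated difference, product. -/
inductive NExp where
  | lit (c : ℕ)
  | get (a : ℕ) (i : NExp)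
  | add (e f : NExp)
  | sub (e f : NExp)
  | mul (e f : NExp)

/-- Expressions for real numbers: a rational constant, the content of cell `i` of an array of
reals, the value of a natural number, and the four arithmetic operations (with `x / 0 = 0`). -/
inductive RExp where
  | lit (c : ℚ)
  | get (a : ℕ) (i : NExp)
  | ofNat (e : NExp)
  | add (e f : RExp)
  | sub (e f : RExp)
  | mul (e f : RExp)
  | div (e f : RExp)

/-- Tests: comparisons of naturals and of reals, and their Boolean combinations. -/
inductive BExp where
  | nle (e f : NExp)
  | rle (e f : RExp)
  | not (b : BExp)
  | and (b c : BExp)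

/-- Programs. -/
inductive Cmd where
  /-- Do nothing. -/
  | skip
  /-- Cell `i` of the array `a` of naturals becomes `e`. -/
  | setN (a : ℕ) (i e : NExp)
  /-- Cell `i` of the array `a` of reals becomes `e`. -/
  | setR (a : ℕ) (i : NExp) (e : RExp)
  /-- Preprocess cells `0, …, m - 1` of the array `a` of reals into the sampler number `k`. -/
  | prep (k a : ℕ) (m : NExp)
  /-- Cell `i` of the array `a` of naturals becomes a fresh sample from the sampler `k`. -/
  | draw (a : ℕ) (i : NExp) (k : ℕ)
  | seq (c₁ c₂ : Cmd)
  | ite (b : BExp) (c₁ c₂ : Cmd)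
  | loop (b : BExp) (c : Cmd)

/-- The state of the memory: `nat a i` and `real a i` are the cells number `i` of the arrays number
`a`; `smp k` is the law from which the sampler number `k` currently draws. -/
structure Store where
  nat : ℕ → ℕ → ℕ
  real : ℕ → ℕ → ℝ
  smp : ℕ → PMF ℕ

/-- Write `v` into cell `i` of the array `a` of naturals. -/
def Store.putN (s : Store) (a i v : ℕ) : Store :=
  { s with nat := Function.update s.nat a (Function.update (s.nat a) i v) }

/-- Write `v` into cell `i` of the array `a` of reals. -/
noncomputable def Store.putR (s : Store) (a i : ℕ) (v : ℝ) : Store :=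
  { s with real := Function.update s.real a (Function.update (s.real a) i v) }

def NExp.eval (s : Store) : NExp → ℕ
  | .lit c => c
  | .get a i => s.nat a (i.eval s)
  | .add e f => e.eval s + f.eval s
  | .sub e f => e.eval s - f.eval s
  | .mul e f => e.eval s * f.eval s

noncomputable def RExp.eval (s : Store) : RExp → ℝ
  | .lit c => (c : ℝ)
  | .get a i => s.real a (i.eval s)
  | .ofNat e => (e.eval s : ℝ)
  | .add e f => e.eval s + f.eval s
  | .sub e f => e.eval s - f.eval s
  | .mul e f => e.eval s * f.eval s
  | .div e f => e.eval s / f.eval s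

def BExp.holds (s : Store) : BExp → Prop
  | .nle e f => e.eval s ≤ f.eval s
  | .rle e f => e.eval s ≤ f.eval s
  | .not b => ¬ b.holds s
  | .and b c => b.holds s ∧ c.holds s

theorem sum_weights (m : ℕ) (w : ℕ → ℝ) (h : ∑ j ∈ Finset.range m, |w j| ≠ 0) :
    ∑ i ∈ Finset.range m, (if i < m then
      ENNReal.ofReal (|w i| / ∑ j ∈ Finset.range m, |w j|) else 0) = 1 := by
  have h0 : 0 ≤ ∑ j ∈ Finset.range m, |w j| := Finset.sum_nonneg fun j _ => abs_nonneg _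
  rw [Finset.sum_congr rfl fun i hi => if_pos (Finset.mem_range.1 hi),
    ← ENNReal.ofReal_sum_of_nonneg fun i _ => div_nonneg (abs_nonneg _) h0,
    ← Finset.sum_div, div_self h, ENNReal.ofReal_one]

/-- The law on `{0, …, m - 1}` that gives `i` a probability proportional to `|w i|`. If all the
weights vanish, it is concentrated at `0`. -/
noncomputable def sampleLaw (m : ℕ) (w : ℕ → ℝ) : PMF ℕ :=
  if h : ∑ j ∈ Finset.range m, |w j| = 0 then PMF.pure 0
  else PMF.ofFinset
    (fun i => if i < m then ENNReal.ofReal (|w i| / ∑ j ∈ Finset.range m, |w j|) else 0)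
    (Finset.range m) (sum_weights m w h)
    (fun _ hi => if_neg (fun hlt => hi (Finset.mem_range.2 hlt)))

/-- `Exec c s μ`: every run of `c` from the memory `s` terminates, and `μ` is the joint law of the
final memory and of the number of time units used. Each command and each evaluation of a test costs
one unit, and preprocessing a vector of length `m` for sampling costs `m + 1` units; after this,
each sample costs one unit. All samples are independent of the past. -/
inductive Exec : Cmd → Store → PMF (Store × ℕ) → Prop
  | skip (s : Store) : Exec .skip s (PMF.pure (s, 1))
  | setN (a : ℕ) (i e : NExp) (s : Store) :
      Exec (.setN a i e) s (PMF.pure (s.putN a (i.eval s) (e.eval s), 1))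
  | setR (a : ℕ) (i : NExp) (e : RExp) (s : Store) :
      Exec (.setR a i e) s (PMF.pure (s.putR a (i.eval s) (e.eval s), 1))
  | prep (k a : ℕ) (m : NExp) (s : Store) :
      Exec (.prep k a m) s (PMF.pure
        ({ s with smp := Function.update s.smp k (sampleLaw (m.eval s) (s.real a)) },
          m.eval s + 1))
  | draw (a : ℕ) (i : NExp) (k : ℕ) (s : Store) :
      Exec (.draw a i k) s ((s.smp k).map fun v => (s.putN a (i.eval s) v, 1))
  | seq {c₁ c₂ : Cmd} {s : Store} {μ : PMF (Store × ℕ)} {ν : Store × ℕ → PMF (Store × ℕ)} :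
      Exec c₁ s μ → (∀ r ∈ μ.support, Exec c₂ r.1 (ν r)) →
      Exec (.seq c₁ c₂) s (μ.bind fun r => (ν r).map fun q => (q.1, r.2 + q.2))
  | ite_pos {b : BExp} {c₁ c₂ : Cmd} {s : Store} {μ : PMF (Store × ℕ)} :
      b.holds s → Exec c₁ s μ → Exec (.ite b c₁ c₂) s (μ.map fun r => (r.1, r.2 + 1))
  | ite_neg {b : BExp} {c₁ c₂ : Cmd} {s : Store} {μ : PMF (Store × ℕ)} :
      ¬ b.holds s → Exec c₂ s μ → Exec (.ite b c₁ c₂) s (μ.map fun r => (r.1, r.2 + 1))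
  | loop_stop {b : BExp} {c : Cmd} {s : Store} :
      ¬ b.holds s → Exec (.loop b c) s (PMF.pure (s, 1))
  | loop_step {b : BExp} {c : Cmd} {s : Store} {μ : PMF (Store × ℕ)}
      {ν : Store × ℕ → PMF (Store × ℕ)} :
      b.holds s → Exec c s μ → (∀ r ∈ μ.support, Exec (.loop b c) r.1 (ν r)) →
      Exec (.loop b c) s (μ.bind fun r => (ν r).map fun q => (q.1, r.2 + q.2 + 1))

theorem bind_congr_support {α β : Type*} (μ : PMF α) (f g : α → PMF β)
    (h : ∀ a ∈ μ.support, f a = g a) : μ.bind f = μ.bind g := by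
  ext b
  rw [PMF.bind_apply, PMF.bind_apply]
  refine tsum_congr fun a => ?_
  by_cases ha : μ a = 0
  · rw [ha, zero_mul, zero_mul]
  · rw [h a ((PMF.mem_support_iff μ a).2 ha)]

/-- A program and a memory determine the law of the result. -/
theorem Exec.unique {c : Cmd} {s : Store} {μ : PMF (Store × ℕ)} (h : Exec c s μ) :
    ∀ {μ' : PMF (Store × ℕ)}, Exec c s μ' → μ = μ' := by
  induction h with
  | skip | setN | setR | prep | draw => intro μ' h'; cases h'; rfl
  | seq _ _ ih₁ ih₂ =>
    intro μ' h'
    cases h' with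
    | seq k₁ k₂ =>
      obtain rfl := ih₁ k₁
      exact bind_congr_support _ _ _ fun r hr => by rw [ih₂ r hr (k₂ r hr)]
  | ite_pos hb _ ih =>
    intro μ' h'
    cases h' with
    | ite_pos _ k => rw [ih k]
    | ite_neg hb' _ => exact absurd hb hb'
  | ite_neg hb _ ih =>
    intro μ' h'
    cases h' with
    | ite_pos hb' _ => exact absurd hb' hb
    | ite_neg _ k => rw [ih k]
  | loop_stop hb =>
    intro μ' h'
    cases h' with
    | loop_stop _ => rfl
    | loop_step hb' _ _ => exact absurd hb' hb
  | loop_step hb _ _ ih₁ ih₂ =>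
    intro μ' h'
    cases h' with
    | loop_stop hb' => exact absurd hb hb'
    | loop_step _ k₁ k₂ =>
      obtain rfl := ih₁ k₁
      exact bind_congr_support _ _ _ fun r hr => by rw [ih₂ r hr (k₂ r hr)]

/-! ### Data structures for matrix-vector maintenance -/

/-- The array that holds the list `l`, followed by zeros. -/
def arrayOf {α : Type*} [Zero α] (l : List α) : ℕ → α := fun k => l.getD k 0

/-- The positions of the nonzero entries of `A`, row by row. -/
noncomputable def matSupport {n d : ℕ} (A : Matrix (Fin n) (Fin d) ℝ) : List (Fin n × Fin d) :=
  (List.finRange n ×ˢ List.finRange d).filter fun q => A q.1 q.2 ≠ 0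

/-- The positions of the nonzero coordinates of `v`. -/
noncomputable def vecSupport {d : ℕ} (v : Fin d → ℝ) : List (Fin d) :=
  (List.finRange d).filter fun j => v j ≠ 0

/-- The number of nonzero entries of a matrix. -/
noncomputable def nnzMat {n d : ℕ} (A : Matrix (Fin n) (Fin d) ℝ) : ℕ :=
  (Finset.univ.filter fun q : Fin n × Fin d => A q.1 q.2 ≠ 0).card

/-- The number of nonzero coordinates of a vector, with the convention that it is at least one
(even an update by the zero vector takes a unit of time to be received). -/
noncomputable def nnzVec {d : ℕ} (v : Fin d → ℝ) : ℕ :=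
  max 1 (Finset.univ.filter fun j : Fin d => v j ≠ 0).card

/-- The memory when `init` is called with `A`, `x₀`, `R`, `ε` and failure probability `δ`.
Naturals: array `0` is `n, d` and the number of nonzero entries of `A`; the arrays `1` and `2` list
the rows and columns of these entries. Reals: array `0` is `R, ε, δ`; array `1` lists the nonzero
entries of `A`, in the same order; array `2` is `x₀`. All other cells are zero. -/
noncomputable def inputStore {n d : ℕ} (A : Matrix (Fin n) (Fin d) ℝ) (x₀ : Fin d → ℝ)
    (R ε δ : ℝ) : Store where
  nat a := match a with
    | 0 => arrayOf [n, d, (matSupport A).length]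
    | 1 => arrayOf ((matSupport A).map fun q => (q.1 : ℕ))
    | 2 => arrayOf ((matSupport A).map fun q => (q.2 : ℕ))
    | _ => fun _ => 0
  real a := match a with
    | 0 => arrayOf [R, ε, δ]
    | 1 => arrayOf ((matSupport A).map fun q => A q.1 q.2)
    | 2 => arrayOf (List.ofFn x₀)
    | _ => fun _ => 0
  smp _ := PMF.pure 0

/-- The memory when `query` is called with `v` while the memory was `s`: the nonzero coordinates of
`v` are passed as a list, through the arrays `3` (their number) and `4` (their positions) of
naturals and the array `3` (their values) of reals. Everything else is as the data structure left
it. -/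
noncomputable def Store.feed (s : Store) {d : ℕ} (v : Fin d → ℝ) : Store :=
  { s with
    nat := Function.update
      (Function.update s.nat 3 (arrayOf [(vecSupport v).length]))
      4 (arrayOf ((vecSupport v).map fun j => (j : ℕ)))
    real := Function.update s.real 3 (arrayOf ((vecSupport v).map v)) }

/-- The output vector of the data structure: the first `n` cells of the array `4` of reals. It stays
in the memory between queries, so that only the coordinates that change have to be written. -/
def Store.output (s : Store) (n : ℕ) : Fin n → ℝ := fun i => s.real 4 i

/-- What is recorded of an interaction: the current memory, the outputs `out t` of the queries
number `t = 1, 2, …` so far, and the total time used so far. -/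
structure Record (n : ℕ) where
  store : Store
  out : ℕ → Fin n → ℝ
  time : ℕ

/-- `Session ini qry s₀ Δ T μ`: the program `ini` is run from the memory `s₀`, then `qry` is run `T`
times, for the updates `Δ 0, …, Δ (T - 1)`, which are revealed one at a time; all these runs
terminate, and `μ` is the law of the record. The updates are fixed in advance, i.e. do not depend on
the samples that the programs draw (oblivious adversary). -/
inductive Session (ini qry : Cmd) (s₀ : Store) {n d : ℕ} (Δ : ℕ → Fin d → ℝ) :
    ℕ → PMF (Record n) → Prop
  | start {μ : PMF (Store × ℕ)} :
      Exec ini s₀ μ → Session ini qry s₀ Δ 0 (μ.map fun r => ⟨r.1, fun _ => 0, r.2⟩)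
  | query {t : ℕ} {μ : PMF (Record n)} {ν : Record n → PMF (Store × ℕ)} :
      Session ini qry s₀ Δ t μ →
      (∀ r ∈ μ.support, Exec qry (r.store.feed (Δ t)) (ν r)) →
      Session ini qry s₀ Δ (t + 1) (μ.bind fun r => (ν r).map fun q =>
        ⟨q.1, Function.update r.out (t + 1) (q.1.output n), r.time + q.2⟩)

/-- The `ℓ_p` norm. -/
noncomputable def lpNorm (p : ℕ) {d : ℕ} (v : Fin d → ℝ) : ℝ := ‖WithLp.toLp (p : ℝ≥0∞) v‖

/-- The operator norm of `A` from `ℓ_p` to `ℓ_∞` (the norm of `Fin n → ℝ` is the maximum norm). -/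
noncomputable def opNormToInf (p : ℕ) {n d : ℕ} (A : Matrix (Fin n) (Fin d) ℝ) : ℝ :=
  sSup {r : ℝ | ∃ v : Fin d → ℝ, lpNorm p v = 1 ∧ r = ‖A.mulVec v‖}

/-- The time bound, up to a constant factor. -/
noncomputable def timeBound (p : ℕ) {n d : ℕ} (A : Matrix (Fin n) (Fin d) ℝ) (R ε δ : ℝ)
    (Δ : ℕ → Fin d → ℝ) (T : ℕ) : ℝ :=
  ∑ t ∈ Finset.range T, (nnzVec (Δ t) : ℝ)
    + ((nnzMat A : ℝ) * Real.log (R / ε) ^ (p - 1) + (d : ℝ) * (R / ε))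
      * Real.log ((n : ℝ) * R / (ε * δ)) ^ (p - 1)
    + (n : ℝ) * (R / ε) ^ 2 * Real.log ((n : ℝ) * R / (ε * δ))

end RealRAM

open RealRAM

namespace RealRAM

/-! ### Expectations and a program logic -/

/-! The data structure collects the updates in a vector D and leaves the output y alone while ‖D‖_p
< ε/2; as ‖A‖_{p→∞} ≤ 1, ignoring D costs at most ε/2 in each coordinate. Once ‖D‖_p ≥ ε/2, a
rebuild adds to y a sum of J independent estimates of A D / J and empties D. For p = 1 an estimate
is a column j of A, drawn with probability |D_j|/‖D‖₁ and scaled by ±‖D‖₁/J. For p = 2 it is a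
single entry, drawn with probability A_ij²/‖A‖_F², which changes row i by ‖A‖_F² D_j/(A_ij J),
unless this is too large.

Errors of rebuilds are never repaired, but as the estimates are almost unbiased, they add up like a
random walk. Let e be y minus A times the part of x already processed, and let W be the number of
parts processed, where a rebuild counts as m = ⌈‖D‖_p/(ε/2)⌉ parts. The potential is exp(-(Lε/2R) W)
· ∑_i 2 cosh((8L/ε) e_i), with L the least integer such that nR ≤ 2^L εδ. One draw multiplies the
mean of the cosh sum by at most exp γ (`sum_exp_le`, `expect_changeOne_le`, `expect_changeTwo_le`),
and γJ = (Lε/2R) m, so the potential is a supermartingale (`runs_rebuild_parts`, `runs_queryProg`).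
It starts at 2n. Rounding up to m at most doubles, so W ≤ 4R/ε throughout (`sum_work_le`), and an
output that is off by more than ε forces the potential up to exp(4L - 2L) (`exp_le_potential`).
Stopping at the first bad output and applying Markov's inequality once
(`Session.exists_of_potential`) bounds the failure probability by 2n exp(-2L) ≤ δ, without a union
bound over the T queries.

A part costs O(d + nK) time with K about 64RL/ε, so W parts fit into the bound (`time_le`). The
programs are verified in a Hoare logic, `RunsE`, whose triples carry a postcondition, a worst-case
time and the expectation of a potential together. -/

/-- The expectation of a nonnegative function. -/
noncomputable def expect {α : Type*} (μ : PMF α) (F : α → ℝ≥0∞) : ℝ≥0∞ := ∑' a, μ a * F a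

theorem expect_pure {α : Type*} (a : α) (F : α → ℝ≥0∞) : expect (PMF.pure a) F = F a := by
  rw [expect, tsum_eq_single a]
  · simp
  · intro b hb
    simp [hb]

theorem expect_bind {α β : Type*} (μ : PMF α) (ν : α → PMF β) (F : β → ℝ≥0∞) :
    expect (μ.bind ν) F = expect μ fun a => expect (ν a) F := by
  simp only [expect, PMF.bind_apply, ← ENNReal.tsum_mul_left, ← ENNReal.tsum_mul_right]
  rw [ENNReal.tsum_comm]
  simp only [mul_assoc]

theorem expect_map {α β : Type*} (μ : PMF α) (f : α → β) (F : β → ℝ≥0∞) :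
    expect (μ.map f) F = expect μ fun a => F (f a) := by
  rw [PMF.map, expect_bind]
  simp only [Function.comp_apply, expect_pure]

theorem expect_mono {α : Type*} {μ : PMF α} {F G : α → ℝ≥0∞}
    (h : ∀ a ∈ μ.support, F a ≤ G a) : expect μ F ≤ expect μ G := by
  refine ENNReal.tsum_le_tsum fun a => ?_
  by_cases ha : μ a = 0
  · simp [ha]
  · exact mul_le_mul_right (h a ((PMF.mem_support_iff μ a).2 ha)) _

theorem expect_const {α : Type*} (μ : PMF α) (b : ℝ≥0∞) : expect μ (fun _ => b) = b := by
  rw [expect, ENNReal.tsum_mul_right, μ.tsum_coe, one_mul]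

theorem expect_zero {α : Type*} (μ : PMF α) : expect μ (fun _ => 0) = 0 := expect_const μ 0

theorem expect_const_mul {α : Type*} (μ : PMF α) (x : ℝ≥0∞) (F : α → ℝ≥0∞) :
    expect μ (fun a => x * F a) = x * expect μ F := by
  simp only [expect, ← ENNReal.tsum_mul_left]
  exact tsum_congr fun a => mul_left_comm _ _ _

/-- Markov's inequality. -/
theorem mul_toOuterMeasure_le_expect {α : Type*} (μ : PMF α) (F : α → ℝ≥0∞) (S : Set α)
    (H : ℝ≥0∞) (h : ∀ a ∈ μ.support, a ∈ S → H ≤ F a) : H * μ.toOuterMeasure S ≤ expect μ F := by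
  rw [PMF.toOuterMeasure_apply, ← ENNReal.tsum_mul_left]
  refine ENNReal.tsum_le_tsum fun a => ?_
  by_cases ha : a ∈ S
  · rw [Set.indicator_of_mem ha, mul_comm]
    by_cases h0 : μ a = 0
    · simp [h0]
    · exact mul_le_mul_right (h a ((PMF.mem_support_iff μ a).2 h0) ha) _
  · simp [ha]

/-- All runs of `c` from `s` end within time `t` in a memory that satisfies `Q`, and the expectation
of `F` at the end is at most `B`. -/
def RunsE (c : Cmd) (s : Store) (t : ℕ) (Q : Store → Prop) (F : Store → ℝ≥0∞) (B : ℝ≥0∞) : Prop :=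
  ∃ μ, Exec c s μ ∧ (∀ r ∈ μ.support, Q r.1 ∧ r.2 ≤ t) ∧ expect μ (fun r => F r.1) ≤ B

/-- All runs of `c` from `s` end within time `t` in a memory that satisfies `Q`. -/
def Runs (c : Cmd) (s : Store) (t : ℕ) (Q : Store → Prop) : Prop := RunsE c s t Q (fun _ => 0) 0

theorem RunsE.mono {c : Cmd} {s : Store} {t t' : ℕ} {Q Q' : Store → Prop} {F F' : Store → ℝ≥0∞}
    {B B' : ℝ≥0∞} (h : RunsE c s t Q F B) (ht : t ≤ t') (hQ : ∀ s', Q s' → Q' s')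
    (hF : ∀ s', Q s' → F' s' ≤ F s') (hB : B ≤ B') :
    RunsE c s t' Q' F' B' := by
  obtain ⟨μ, h1, h2, h3⟩ := h
  exact ⟨μ, h1, fun r hr => ⟨hQ _ (h2 r hr).1, (h2 r hr).2.trans ht⟩,
    (expect_mono fun r hr => hF _ (h2 r hr).1).trans (h3.trans hB)⟩

theorem RunsE.const_mul {c : Cmd} {s : Store} {t : ℕ} {Q : Store → Prop} {F : Store → ℝ≥0∞}
    {B : ℝ≥0∞} (h : RunsE c s t Q F B) (x : ℝ≥0∞) :
    RunsE c s t Q (fun s' => x * F s') (x * B) := by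
  obtain ⟨μ, h1, h2, h3⟩ := h
  exact ⟨μ, h1, h2, (expect_const_mul μ x _).trans_le (mul_le_mul_right h3 x)⟩

theorem Runs.mono {c : Cmd} {s : Store} {t t' : ℕ} {Q Q' : Store → Prop}
    (h : Runs c s t Q) (ht : t ≤ t') (hQ : ∀ s', Q s' → Q' s') : Runs c s t' Q' :=
  RunsE.mono h ht hQ (fun _ _ => le_rfl) le_rfl

theorem Runs.toRunsE {c : Cmd} {s : Store} {t : ℕ} {Q : Store → Prop} (h : Runs c s t Q)
    {F : Store → ℝ≥0∞} {B : ℝ≥0∞} (hF : ∀ s', Q s' → F s' ≤ B) : RunsE c s t Q F B := by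
  obtain ⟨μ, h1, h2, -⟩ := h
  refine ⟨μ, h1, h2, ?_⟩
  rw [← expect_const μ B]
  exact expect_mono fun r hr => hF _ (h2 r hr).1

theorem Runs.of_pure {c : Cmd} {s s' : Store} {t t' : ℕ} {Q : Store → Prop}
    (h : Exec c s (PMF.pure (s', t'))) (ht : t' ≤ t) (hQ : Q s') : Runs c s t Q := by
  refine ⟨_, h, fun r hr => ?_, (expect_zero _).le⟩
  rw [PMF.support_pure, Set.mem_singleton_iff] at hr
  subst hr
  exact ⟨hQ, ht⟩

theorem Runs.skip {s : Store} {Q : Store → Prop} (h : Q s) : Runs .skip s 1 Q :=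
  .of_pure (.skip s) le_rfl h

theorem Runs.setN {s : Store} {a : ℕ} {i e : NExp} {Q : Store → Prop}
    (h : Q (s.putN a (i.eval s) (e.eval s))) : Runs (.setN a i e) s 1 Q :=
  .of_pure (.setN a i e s) le_rfl h

theorem Runs.setR {s : Store} {a : ℕ} {i : NExp} {e : RExp} {Q : Store → Prop}
    (h : Q (s.putR a (i.eval s) (e.eval s))) : Runs (.setR a i e) s 1 Q :=
  .of_pure (.setR a i e s) le_rfl h

/-- The memory after preprocessing the first `m` cells of the array `a` into the sampler `k`. -/
noncomputable def Store.prepare (s : Store) (k a m : ℕ) : Store :=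
  { s with smp := Function.update s.smp k (sampleLaw m (s.real a)) }

theorem Runs.prep {s : Store} {k a : ℕ} {m : NExp} {Q : Store → Prop}
    (h : Q (s.prepare k a (m.eval s))) : Runs (.prep k a m) s (m.eval s + 1) Q :=
  .of_pure (.prep k a m s) le_rfl h

/-- The potential `F₁` at the intermediate memory is the budget of the second program, so this is
the tower rule for supermartingales. Unreachable results get a dummy law, since `ν` has to be total.
-/
theorem RunsE.seq {c₁ c₂ : Cmd} {s : Store} {t₁ t₂ : ℕ} {Q₁ Q₂ : Store → Prop}
    {F₁ F₂ : Store → ℝ≥0∞} {B : ℝ≥0∞} (h₁ : RunsE c₁ s t₁ Q₁ F₁ B)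
    (h₂ : ∀ s', Q₁ s' → RunsE c₂ s' t₂ Q₂ F₂ (F₁ s')) :
    RunsE (.seq c₁ c₂) s (t₁ + t₂) Q₂ F₂ B := by
  classical
  obtain ⟨μ, e, q, f⟩ := h₁
  have key : ∀ r : Store × ℕ, ∃ ν, r ∈ μ.support → Exec c₂ r.1 ν ∧
      (∀ r' ∈ ν.support, Q₂ r'.1 ∧ r'.2 ≤ t₂) ∧ expect ν (fun r' => F₂ r'.1) ≤ F₁ r.1 := by
    intro r
    by_cases hr : r ∈ μ.support
    · obtain ⟨ν, hν⟩ := h₂ r.1 (q r hr).1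
      exact ⟨ν, fun _ => hν⟩
    · exact ⟨PMF.pure r, fun h => absurd h hr⟩
  choose ν hν using key
  refine ⟨_, Exec.seq e fun r hr => (hν r hr).1, ?_, ?_⟩
  · intro r hr
    obtain ⟨r₁, hr₁, hr⟩ := (PMF.mem_support_bind_iff _ _ _).1 hr
    obtain ⟨r₂, hr₂, rfl⟩ := (PMF.mem_support_map_iff _ _ _).1 hr
    exact ⟨((hν r₁ hr₁).2.1 r₂ hr₂).1, add_le_add (q r₁ hr₁).2 ((hν r₁ hr₁).2.1 r₂ hr₂).2⟩
  · rw [expect_bind]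
    refine (expect_mono fun r hr => ?_).trans f
    rw [expect_map]
    exact (hν r hr).2.2

theorem Runs.seqE {c₁ c₂ : Cmd} {s : Store} {t₁ t₂ : ℕ} {Q₁ Q₂ : Store → Prop}
    {F : Store → ℝ≥0∞} {B : ℝ≥0∞} (h₁ : Runs c₁ s t₁ Q₁)
    (h₂ : ∀ s', Q₁ s' → RunsE c₂ s' t₂ Q₂ F B) :
    RunsE (.seq c₁ c₂) s (t₁ + t₂) Q₂ F B :=
  (h₁.toRunsE (F := fun _ => B) fun _ _ => le_rfl).seq h₂

theorem Runs.seq {c₁ c₂ : Cmd} {s : Store} {t₁ t₂ : ℕ} {Q₁ Q₂ : Store → Prop}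
    (h₁ : Runs c₁ s t₁ Q₁) (h₂ : ∀ s', Q₁ s' → Runs c₂ s' t₂ Q₂) :
    Runs (.seq c₁ c₂) s (t₁ + t₂) Q₂ :=
  RunsE.seq h₁ h₂

theorem RunsE.setN_seq {s : Store} {a t : ℕ} {i e : NExp} {c : Cmd} {Q : Store → Prop}
    {F : Store → ℝ≥0∞} {B : ℝ≥0∞} (h : RunsE c (s.putN a (i.eval s) (e.eval s)) t Q F B) :
    RunsE (.seq (.setN a i e) c) s (1 + t) Q F B :=
  (Runs.setN (Q := fun s' => s' = _) rfl).seqE fun s' hs => by subst hs; exact h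

theorem RunsE.setR_seq {s : Store} {a t : ℕ} {i : NExp} {e : RExp} {c : Cmd} {Q : Store → Prop}
    {F : Store → ℝ≥0∞} {B : ℝ≥0∞} (h : RunsE c (s.putR a (i.eval s) (e.eval s)) t Q F B) :
    RunsE (.seq (.setR a i e) c) s (1 + t) Q F B :=
  (Runs.setR (Q := fun s' => s' = _) rfl).seqE fun s' hs => by subst hs; exact h

theorem RunsE.draw_seq {s : Store} {a k t : ℕ} {i : NExp} {c : Cmd} {Q : Store → Prop}
    {F : Store → ℝ≥0∞} (g : ℕ → ℝ≥0∞)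
    (h : ∀ v ∈ (s.smp k).support, RunsE c (s.putN a (i.eval s) v) t Q F (g v)) :
    RunsE (.seq (.draw a i k) c) s (1 + t) Q F (expect (s.smp k) g) := by
  -- The sample can be read back from the cell just written, which makes `g` a function of the
  -- memory.
  refine RunsE.seq (Q₁ := fun s' => ∃ v ∈ (s.smp k).support, s' = s.putN a (i.eval s) v)
    (F₁ := fun s' => g (s'.nat a (i.eval s))) ⟨_, .draw a i k s, fun r hr => ?_, ?_⟩ ?_
  · obtain ⟨v, hv, rfl⟩ := (PMF.mem_support_map_iff _ _ _).1 hr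
    exact ⟨⟨v, hv, rfl⟩, le_rfl⟩
  · rw [expect_map]
    simp [Store.putN]
  · rintro s' ⟨v, hv, rfl⟩
    simpa [Store.putN] using h v hv

theorem RunsE.ite {b : BExp} {c₁ c₂ : Cmd} {s : Store} {t : ℕ} {Q : Store → Prop}
    {F : Store → ℝ≥0∞} {B : ℝ≥0∞} (h₁ : b.holds s → RunsE c₁ s t Q F B)
    (h₂ : ¬ b.holds s → RunsE c₂ s t Q F B) : RunsE (.ite b c₁ c₂) s (t + 1) Q F B := by
  by_cases hb : b.holds s
  · obtain ⟨μ, e, q, f⟩ := h₁ hb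
    refine ⟨_, .ite_pos hb e, fun r hr => ?_, by rwa [expect_map]⟩
    obtain ⟨r₁, hr₁, rfl⟩ := (PMF.mem_support_map_iff _ _ _).1 hr
    exact ⟨(q r₁ hr₁).1, Nat.succ_le_succ (q r₁ hr₁).2⟩
  · obtain ⟨μ, e, q, f⟩ := h₂ hb
    refine ⟨_, .ite_neg hb e, fun r hr => ?_, by rwa [expect_map]⟩
    obtain ⟨r₁, hr₁, rfl⟩ := (PMF.mem_support_map_iff _ _ _).1 hr
    exact ⟨(q r₁ hr₁).1, Nat.succ_le_succ (q r₁ hr₁).2⟩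

theorem RunsE.loop_step {b : BExp} {c : Cmd} {s : Store} {t₁ t₂ : ℕ} {Q₁ Q₂ : Store → Prop}
    {F₁ F₂ : Store → ℝ≥0∞} {B : ℝ≥0∞} (hb : b.holds s) (h₁ : RunsE c s t₁ Q₁ F₁ B)
    (h₂ : ∀ s', Q₁ s' → RunsE (.loop b c) s' t₂ Q₂ F₂ (F₁ s')) :
    RunsE (.loop b c) s (t₁ + t₂ + 1) Q₂ F₂ B := by
  classical
  obtain ⟨μ, e, q, f⟩ := h₁
  have key : ∀ r : Store × ℕ, ∃ ν, r ∈ μ.support → Exec (.loop b c) r.1 ν ∧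
      (∀ r' ∈ ν.support, Q₂ r'.1 ∧ r'.2 ≤ t₂) ∧ expect ν (fun r' => F₂ r'.1) ≤ F₁ r.1 := by
    intro r
    by_cases hr : r ∈ μ.support
    · obtain ⟨ν, hν⟩ := h₂ r.1 (q r hr).1
      exact ⟨ν, fun _ => hν⟩
    · exact ⟨PMF.pure r, fun h => absurd h hr⟩
  choose ν hν using key
  refine ⟨_, Exec.loop_step hb e fun r hr => (hν r hr).1, ?_, ?_⟩
  · intro r hr
    obtain ⟨r₁, hr₁, hr⟩ := (PMF.mem_support_bind_iff _ _ _).1 hr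
    obtain ⟨r₂, hr₂, rfl⟩ := (PMF.mem_support_map_iff _ _ _).1 hr
    exact ⟨((hν r₁ hr₁).2.1 r₂ hr₂).1,
      Nat.succ_le_succ (add_le_add (q r₁ hr₁).2 ((hν r₁ hr₁).2.1 r₂ hr₂).2)⟩
  · rw [expect_bind]
    refine (expect_mono fun r hr => ?_).trans f
    rw [expect_map]
    exact (hν r hr).2.2

/-- The rule for a loop that makes `N` rounds, with an invariant `I` and a potential `F`. -/
theorem RunsE.loop {b : BExp} {c : Cmd} {s : Store} {t N : ℕ} (I : ℕ → Store → Prop)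
    (F : ℕ → Store → ℝ≥0∞) (h0 : I 0 s)
    (hstep : ∀ k < N, ∀ s', I k s' → b.holds s' ∧ RunsE c s' t (I (k + 1)) (F (k + 1)) (F k s'))
    (hdone : ∀ s', I N s' → ¬ b.holds s') :
    RunsE (.loop b c) s (N * (t + 1) + 1) (I N) (F N) (F 0 s) := by
  -- Induction on the number `k` of rounds still to be made.
  have key : ∀ k ≤ N, ∀ s', I (N - k) s' →
      RunsE (.loop b c) s' (k * (t + 1) + 1) (I N) (F N) (F (N - k) s') := by
    intro k
    induction k with
    | zero =>
      intro _ s' hs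
      have := Runs.of_pure (Q := fun s₁ => I N s₁ ∧ F N s₁ ≤ F N s') (t := 1)
        (Exec.loop_stop (b := b) (c := c) (hdone s' hs)) le_rfl ⟨hs, le_rfl⟩
      simpa using (this.toRunsE (F := F N) fun _ h => h.2).mono le_rfl (fun _ h => h.1)
        (fun _ _ => le_rfl) le_rfl
    | succ k ih =>
      intro hk s' hs
      obtain ⟨hb, hr⟩ := hstep (N - (k + 1)) (by omega) s' hs
      have e : N - (k + 1) + 1 = N - k := by omega
      rw [e] at hr
      refine (RunsE.loop_step hb hr fun s₁ h₁ => ih (by omega) s₁ h₁).mono ?_ (fun _ h => h)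
        (fun _ _ => le_rfl) le_rfl
      ring_nf
      omega
  simpa using key N le_rfl s (by simpa using h0)

theorem Runs.loop {b : BExp} {c : Cmd} {s : Store} {t N : ℕ} (I : ℕ → Store → Prop) (h0 : I 0 s)
    (hstep : ∀ k < N, ∀ s', I k s' → b.holds s' ∧ Runs c s' t (I (k + 1)))
    (hdone : ∀ s', I N s' → ¬ b.holds s') :
    Runs (.loop b c) s (N * (t + 1) + 1) (I N) :=
  RunsE.loop I (fun _ _ => 0) h0 hstep hdone

/-! ### Reading the memory -/

@[simp] theorem Store.putN_nat (s : Store) (a i v b j : ℕ) :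
    (s.putN a i v).nat b j = if b = a ∧ j = i then v else s.nat b j := by
  by_cases h : b = a
  · subst h
    by_cases h' : j = i <;> simp [Store.putN, h']
  · simp [Store.putN, h]

@[simp] theorem Store.putN_real (s : Store) (a i v : ℕ) : (s.putN a i v).real = s.real := rfl

@[simp] theorem Store.putN_smp (s : Store) (a i v : ℕ) : (s.putN a i v).smp = s.smp := rfl

@[simp] theorem Store.putR_real (s : Store) (a i : ℕ) (v : ℝ) (b j : ℕ) :
    (s.putR a i v).real b j = if b = a ∧ j = i then v else s.real b j := by
  by_cases h : b = a
  · subst h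
    by_cases h' : j = i <;> simp [Store.putR, h']
  · simp [Store.putR, h]

@[simp] theorem Store.putR_nat (s : Store) (a i : ℕ) (v : ℝ) : (s.putR a i v).nat = s.nat := rfl

@[simp] theorem Store.putR_smp (s : Store) (a i : ℕ) (v : ℝ) : (s.putR a i v).smp = s.smp := rfl

@[simp] theorem Store.prepare_nat (s : Store) (k a m : ℕ) : (s.prepare k a m).nat = s.nat := rfl

@[simp] theorem Store.prepare_real (s : Store) (k a m : ℕ) : (s.prepare k a m).real = s.real := rfl

@[simp] theorem Store.prepare_smp (s : Store) (k a m k' : ℕ) :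
    (s.prepare k a m).smp k' = if k' = k then sampleLaw m (s.real a) else s.smp k' := by
  simp [Store.prepare, Function.update_apply]

/-- The powers of an expression. -/
def RExp.pow (e : RExp) : ℕ → RExp
  | 0 => .lit 1
  | p + 1 => .mul (e.pow p) e

@[simp] theorem RExp.eval_pow (s : Store) (e : RExp) (p : ℕ) :
    (e.pow p).eval s = e.eval s ^ p := by
  induction p with
  | zero => simp [RExp.pow, RExp.eval]
  | succ p ih => rw [RExp.pow, RExp.eval, ih, pow_succ]

/-! ### Sessions -/

/-- A query that does not increase the expectation of the potential `G` keeps the probability small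
that an output is ever bad, if a bad output forces the potential to be at least `H`. -/
theorem Session.exists_of_potential {ini qry : Cmd} {s₀ : Store} {n d : ℕ} {Δ : ℕ → Fin d → ℝ}
    {T t₀ : ℕ} {τ : ℕ → ℕ} (J : ℕ → Store → Prop) (G : ℕ → Store → ℝ≥0∞) {B H : ℝ≥0∞}
    (bad : ℕ → (Fin n → ℝ) → Prop)
    (h0 : RunsE ini s₀ t₀ (J 0) (G 0) B)
    (hq : ∀ t < T, ∀ s, J t s → RunsE qry (s.feed (Δ t)) (τ t) (J (t + 1)) (G (t + 1)) (G t s))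
    (hbad : ∀ t < T, ∀ s, J (t + 1) s → bad (t + 1) (s.output n) → H ≤ G (t + 1) s) :
    ∃ μ, Session ini qry s₀ Δ T μ ∧
      (∀ ω ∈ μ.support, ω.time ≤ t₀ + ∑ t ∈ Finset.range T, τ t) ∧
      H * μ.toOuterMeasure {ω : Record n | ∃ t, 1 ≤ t ∧ t ≤ T ∧ bad t (ω.out t)} ≤ B := by
  classical
  -- The potential stopped at the first bad output: it is frozen at `H` from then on, so its mean
  -- stays at most `B`, and Markov's inequality for the final `W` covers all times at once.
  let W : ℕ → Record n → ℝ≥0∞ := fun T ω =>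
    if ∃ t, 1 ≤ t ∧ t ≤ T ∧ bad t (ω.out t) then H else G T ω.store
  have key : ∀ t ≤ T, ∃ μ, Session ini qry s₀ Δ t μ ∧
      (∀ ω ∈ μ.support, J t ω.store ∧ ω.time ≤ t₀ + ∑ i ∈ Finset.range t, τ i) ∧
      expect μ (W t) ≤ B := by
    intro t
    induction t with
    | zero =>
      intro _
      obtain ⟨μ, e, q, f⟩ := h0
      refine ⟨_, .start e, fun ω hω => ?_, ?_⟩
      · obtain ⟨r, hr, rfl⟩ := (PMF.mem_support_map_iff _ _ _).1 hω
        simpa using q r hr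
      · rw [expect_map]
        refine le_trans (expect_mono fun r _ => ?_) f
        dsimp only [W]
        rw [if_neg]
        rintro ⟨t, h1, h2, -⟩
        omega
    | succ t ih =>
      intro ht
      obtain ⟨μ, hμ, hJ, hW⟩ := ih (by omega)
      have key : ∀ ω : Record n, ∃ ν, ω ∈ μ.support → Exec qry (ω.store.feed (Δ t)) ν ∧
          (∀ r ∈ ν.support, J (t + 1) r.1 ∧ r.2 ≤ τ t) ∧
          expect ν (fun r => G (t + 1) r.1) ≤ G t ω.store := by
        intro ω
        by_cases hω : ω ∈ μ.support
        · obtain ⟨ν, hν⟩ := hq t (by omega) ω.store (hJ ω hω).1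
          exact ⟨ν, fun _ => hν⟩
        · exact ⟨PMF.pure (ω.store, 0), fun h => absurd h hω⟩
      choose ν hν using key
      refine ⟨_, .query hμ fun ω hω => (hν ω hω).1, fun ω hω => ?_, ?_⟩
      · obtain ⟨ω₁, h₁, hω⟩ := (PMF.mem_support_bind_iff _ _ _).1 hω
        obtain ⟨r, hr, rfl⟩ := (PMF.mem_support_map_iff _ _ _).1 hω
        refine ⟨((hν ω₁ h₁).2.1 r hr).1, ?_⟩
        rw [Finset.sum_range_succ, ← add_assoc]
        exact add_le_add (hJ ω₁ h₁).2 ((hν ω₁ h₁).2.1 r hr).2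
      · rw [expect_bind]
        refine le_trans (expect_mono fun ω hω => ?_) hW
        rw [expect_map]
        have old : ∀ (y : Fin n → ℝ) i, i ≤ t → Function.update ω.out (t + 1) y i = ω.out i :=
          fun y i hi => Function.update_of_ne (by omega) _ _
        by_cases hb : ∃ i, 1 ≤ i ∧ i ≤ t ∧ bad i (ω.out i)
        · rw [show W t ω = H from if_pos hb, ← expect_const (ν ω) H]
          refine expect_mono fun r _ => ?_
          obtain ⟨i, h1, h2, h3⟩ := hb
          refine (if_pos ⟨i, h1, by omega, ?_⟩).le
          dsimp only
          rwa [old _ i h2]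
        · rw [show W t ω = G t ω.store from if_neg hb]
          refine le_trans (expect_mono fun r hr => ?_) (hν ω hω).2.2
          dsimp only [W]
          split_ifs with hc
          · obtain ⟨i, h1, h2, h3⟩ := hc
            -- If nothing was bad before, only the newest output can be bad, and then `hbad` allows
            -- `G` to be replaced by `H`.
            rcases Nat.lt_or_ge t i with hi | hi
            · obtain rfl : i = t + 1 := by omega
              rw [Function.update_self] at h3
              exact hbad t (by omega) r.1 ((hν ω hω).2.1 r hr).1 h3
            · rw [old _ i hi] at h3
              exact absurd ⟨i, h1, hi, h3⟩ hb
          · exact le_rfl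
  obtain ⟨μ, hμ, hJ, hW⟩ := key T le_rfl
  refine ⟨μ, hμ, fun ω hω => (hJ ω hω).2, ?_⟩
  exact (mul_toOuterMeasure_le_expect μ (W T) _ H fun ω _ hω => (if_pos hω).ge).trans hW

theorem one_sub_le_toOuterMeasure {α : Type*} (μ : PMF α) {S S' : Set α} {B H : ℝ≥0∞} {δ : ℝ}
    (hS : ∀ a, a ∈ S ∨ a ∈ S') (hδ : 0 ≤ δ) (hH : H ≠ 0) (hH' : H ≠ ∞)
    (h : H * μ.toOuterMeasure S' ≤ B) (hB : B ≤ H * ENNReal.ofReal δ) :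
    ENNReal.ofReal (1 - δ) ≤ μ.toOuterMeasure S := by
  have h1 : μ.toOuterMeasure S' ≤ ENNReal.ofReal δ :=
    (ENNReal.mul_le_mul_iff_right hH hH').1 (h.trans hB)
  have h2 : (1 : ℝ≥0∞) ≤ μ.toOuterMeasure S + μ.toOuterMeasure S' := by
    have : μ.toOuterMeasure Set.univ = 1 :=
      (PMF.toOuterMeasure_apply_eq_one_iff _ _).2 (Set.subset_univ _)
    rw [← this, ← Set.eq_univ_of_forall (s := S ∪ S') hS]
    exact MeasureTheory.measure_union_le _ _
  rw [ENNReal.ofReal_sub _ hδ, ENNReal.ofReal_one]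
  exact tsub_le_iff_right.2 (h2.trans (add_le_add le_rfl h1))

/-! ### Sampling -/

theorem expect_sampleLaw {m : ℕ} {w : ℕ → ℝ} (h : ∑ j ∈ Finset.range m, |w j| ≠ 0)
    {g : ℕ → ℝ} (hg : ∀ i, 0 ≤ g i) :
    expect (sampleLaw m w) (fun i => ENNReal.ofReal (g i)) =
      ENNReal.ofReal (∑ i ∈ Finset.range m, |w i| / (∑ j ∈ Finset.range m, |w j|) * g i) := by
  have hW : 0 ≤ ∑ j ∈ Finset.range m, |w j| := Finset.sum_nonneg fun j _ => abs_nonneg _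
  rw [expect, sampleLaw, dif_neg h, tsum_eq_sum (s := Finset.range m),
    ENNReal.ofReal_sum_of_nonneg fun i _ => mul_nonneg (div_nonneg (abs_nonneg _) hW) (hg i)]
  · refine Finset.sum_congr rfl fun i hi => ?_
    rw [PMF.ofFinset_apply, if_pos (Finset.mem_range.1 hi),
      ENNReal.ofReal_mul (div_nonneg (abs_nonneg _) hW)]
  · intro i hi
    rw [PMF.ofFinset_apply, if_neg (fun h => hi (Finset.mem_range.2 h)), zero_mul]

theorem lt_of_mem_support_sampleLaw {m : ℕ} {w : ℕ → ℝ} (h : ∑ j ∈ Finset.range m, |w j| ≠ 0)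
    {i : ℕ} (hi : i ∈ (sampleLaw m w).support) : i < m := by
  by_contra hlt
  rw [PMF.mem_support_iff, sampleLaw, dif_neg h, PMF.ofFinset_apply, if_neg hlt] at hi
  exact hi rfl

theorem sampleLaw_of_sum_eq_zero {m : ℕ} {w : ℕ → ℝ} (h : ∑ j ∈ Finset.range m, |w j| = 0) :
    sampleLaw m w = PMF.pure 0 := dif_pos h

/-! ### The exponential potential -/

/-- `∑ i, 2 cosh (l * e i)`. -/
noncomputable def coshSum {n : ℕ} (l : ℝ) (e : Fin n → ℝ) : ℝ :=
  ∑ i, (Real.exp (l * e i) + Real.exp (-l * e i))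

theorem coshSum_nonneg {n : ℕ} (l : ℝ) (e : Fin n → ℝ) : 0 ≤ coshSum l e :=
  Finset.sum_nonneg fun i _ => by positivity

theorem coshSum_zero {n : ℕ} (l : ℝ) : coshSum l (0 : Fin n → ℝ) = 2 * n := by
  simp [coshSum]
  ring

theorem exp_abs_le_coshSum {n : ℕ} {l : ℝ} (e : Fin n → ℝ) (i : Fin n) :
    Real.exp (l * |e i|) ≤ coshSum l e := by
  refine le_trans ?_ (Finset.single_le_sum (f := fun i => Real.exp (l * e i) + Real.exp (-l * e i))
    (fun i _ => by positivity) (Finset.mem_univ i))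
  rcases abs_cases (e i) with ⟨h, -⟩ | ⟨h, -⟩ <;> rw [h]
  · exact le_add_of_nonneg_right (Real.exp_pos _).le
  · rw [mul_neg, ← neg_mul]
    exact le_add_of_nonneg_left (Real.exp_pos _).le

theorem exp_le_one_add_sq {x : ℝ} (hx : |x| ≤ 1) : Real.exp x ≤ 1 + x + x ^ 2 := by
  have := Real.abs_exp_sub_one_sub_id_le hx
  linarith [(abs_le.1 this).2]

/-- A Bernstein-type bound. From exp x ≤ 1 + x + x² for |x| ≤ 1, the exponential moment of `f` is at
most 1 + l · mean + l² · second moment; with 1 + u ≤ exp u and division by exp (lμ), only the bias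
term |l| b and the variance term l² v survive. The bias `b` is there for the truncated estimates of
the case p = 2. -/
theorem sum_exp_le {s : Finset ℕ} {p f : ℕ → ℝ} {l μ b v γ : ℝ} (hp : ∀ q ∈ s, 0 ≤ p q)
    (hp1 : ∑ q ∈ s, p q = 1) (hf : ∀ q ∈ s, |l * f q| ≤ 1) (hb : |∑ q ∈ s, p q * f q - μ| ≤ b)
    (hv : ∑ q ∈ s, p q * f q ^ 2 ≤ v) (hγ : |l| * b + l ^ 2 * v ≤ γ) :
    ∑ q ∈ s, p q * Real.exp (l * (f q - μ)) ≤ Real.exp γ := by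
  have h1 : ∑ q ∈ s, p q * Real.exp (l * f q) ≤
      1 + l * ∑ q ∈ s, p q * f q + l ^ 2 * ∑ q ∈ s, p q * f q ^ 2 := by
    rw [← hp1, Finset.mul_sum, Finset.mul_sum, ← Finset.sum_add_distrib, ← Finset.sum_add_distrib]
    refine Finset.sum_le_sum fun q hq => ?_
    have := mul_le_mul_of_nonneg_left (exp_le_one_add_sq (hf q hq)) (hp q hq)
    linarith
  have h2 : l * (∑ q ∈ s, p q * f q - μ) ≤ |l| * b := by
    refine (le_abs_self _).trans ?_
    rw [abs_mul]
    exact mul_le_mul_of_nonneg_left hb (abs_nonneg _)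
  have h3 := mul_le_mul_of_nonneg_left hv (sq_nonneg l)
  have h4 : ∑ q ∈ s, p q * Real.exp (l * (f q - μ)) =
      (∑ q ∈ s, p q * Real.exp (l * f q)) * Real.exp (-(l * μ)) := by
    rw [Finset.sum_mul]
    refine Finset.sum_congr rfl fun q _ => ?_
    rw [mul_assoc, ← Real.exp_add]
    ring_nf
  rw [h4]
  calc _ ≤ Real.exp (γ + l * μ) * Real.exp (-(l * μ)) := by
        gcongr
        have := Real.add_one_le_exp (γ + l * μ)
        linarith
    _ = _ := by rw [← Real.exp_add]; ring_nf

/-- `sum_exp_le` in every row, for `l` and for `-l`. The earlier error `e` does not depend on the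
new draw and factors out of each exponential. -/
theorem sum_coshSum_le {n : ℕ} {s : Finset ℕ} {p : ℕ → ℝ} {f : ℕ → Fin n → ℝ} {l b v γ : ℝ}
    {μ : Fin n → ℝ} (hp : ∀ q ∈ s, 0 ≤ p q) (hp1 : ∑ q ∈ s, p q = 1)
    (hf : ∀ i, ∀ q ∈ s, |l * f q i| ≤ 1) (hb : ∀ i, |∑ q ∈ s, p q * f q i - μ i| ≤ b)
    (hv : ∀ i, ∑ q ∈ s, p q * f q i ^ 2 ≤ v) (hγ : |l| * b + l ^ 2 * v ≤ γ) (e : Fin n → ℝ) :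
    ∑ q ∈ s, p q * coshSum l (fun i => e i + f q i - μ i) ≤ Real.exp γ * coshSum l e := by
  have one : ∀ l' : ℝ, |l'| = |l| → l' ^ 2 = l ^ 2 → ∀ i,
      ∑ q ∈ s, p q * Real.exp (l' * (e i + f q i - μ i)) ≤ Real.exp γ * Real.exp (l' * e i) := by
    intro l' h1 h2 i
    have := sum_exp_le (s := s) (p := p) (f := fun q => f q i) (l := l') (μ := μ i) hp hp1
      (fun q hq => by have := hf i q hq; rw [abs_mul] at this ⊢; rwa [h1]) (hb i) (hv i)
      (γ := γ) (by rwa [h1, h2])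
    refine le_trans (le_of_eq ?_) (mul_le_mul_of_nonneg_right this (Real.exp_pos (l' * e i)).le)
    rw [Finset.sum_mul]
    refine Finset.sum_congr rfl fun q _ => ?_
    rw [mul_assoc, ← Real.exp_add]
    ring_nf
  simp only [coshSum, Finset.mul_sum]
  rw [Finset.sum_comm]
  refine Finset.sum_le_sum fun i _ => ?_
  simp only [mul_add, Finset.sum_add_distrib]
  exact add_le_add (one l rfl rfl i) (one (-l) (abs_neg l) (neg_sq l) i)

/-! ### The programs

Naturals, besides the input: array `5` holds the counters `k` (cell `0`), `L` or `m` (cell `1`), the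
number of draws (cell `2`), the sample (cell `3`) and an inner counter (cell `4`); array `6` is the
number `K`. Reals, besides the input and the output: array `5` is the sum of the updates since the
last rebuild; array `6` holds the `p`-th power of its norm and scratch cells; array `7` is the
matrix `A`, row by row; array `8` holds the rebuild threshold and `∑ A i j ^ 2`; array `9` lists the
squares of the nonzero entries of `A`. -/

/-- Add one to cell `i` of the array `a` of naturals. -/
def incr (a i : ℕ) : Cmd := .setN a (.lit i) (.add (.get a (.lit i)) (.lit 1))

/-- Add `e` to cell `i` of the array `a` of reals. -/
def accum (a : ℕ) (i : NExp) (e : RExp) : Cmd := .setR a i (.add (.get a i) e)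

/-- Repeat `c`, which has to increase the counter `i` of the array `5`, while the counter is less
than `e`. -/
def forLoop (i : ℕ) (e : NExp) (c : Cmd) : Cmd :=
  .seq (.setN 5 (.lit i) (.lit 0)) (.loop (.nle (.add (.get 5 (.lit i)) (.lit 1)) e) c)

/-- Write `f` or `-f` into cell `i` of the array `6` of reals, depending on the sign of `e`. -/
def setAbs (i : NExp) (e : RExp) (f : RExp) : Cmd :=
  .ite (.rle (.lit 0) e) (.setR 6 i f) (.setR 6 i (.sub (.lit 0) f))

/-- Compute the least `L` with `n * R ≤ 2 ^ L * (ε * δ)`. -/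
def initL : Cmd :=
  .seq (.setR 6 (.lit 2) (.lit 1)) <|
  .loop (.not (.rle (.mul (.ofNat (.get 0 (.lit 0))) (.get 0 (.lit 0)))
    (.mul (.get 6 (.lit 2)) (.mul (.get 0 (.lit 1)) (.get 0 (.lit 2)))))) <|
  .seq (accum 6 (.lit 2) (.get 6 (.lit 2))) (incr 5 1)

/-- Compute the least `K` with `64 * R * L ≤ K * ε`. -/
def initK : Cmd :=
  .loop (.not (.rle (.mul (.lit 64) (.mul (.get 0 (.lit 0)) (.ofNat (.get 5 (.lit 1)))))
    (.mul (.ofNat (.get 6 (.lit 0))) (.get 0 (.lit 1))))) (incr 6 0)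

/-- Read the matrix. -/
def initA : Cmd :=
  forLoop 0 (.get 0 (.lit 2)) <|
  .seq (accum 4 (.get 1 (.get 5 (.lit 0)))
    (.mul (.get 1 (.get 5 (.lit 0))) (.get 2 (.get 2 (.get 5 (.lit 0)))))) <|
  .seq (.setR 7 (.add (.mul (.get 1 (.get 5 (.lit 0))) (.get 0 (.lit 1)))
    (.get 2 (.get 5 (.lit 0)))) (.get 1 (.get 5 (.lit 0)))) <|
  .seq (.setR 9 (.get 5 (.lit 0)) (.mul (.get 1 (.get 5 (.lit 0))) (.get 1 (.get 5 (.lit 0))))) <|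
  .seq (accum 8 (.lit 1) (.mul (.get 1 (.get 5 (.lit 0))) (.get 1 (.get 5 (.lit 0)))))
    (incr 5 0)

/-- The dense copy of the matrix costs only time proportional to the number of nonzero entries,
because unwritten cells are zero. Sampler `0` is fed with the squares of the entries; it serves the
case p = 2. -/
def initProg (p : ℕ) : Cmd :=
  .seq initL <| .seq initK <| .seq initA <| .seq (.prep 0 9 (.get 0 (.lit 2))) <|
  .setR 8 (.lit 0) (((RExp.get 0 (.lit 1)).div (.lit 2)).pow p)

/-- The coordinate of the current entry of the update. -/
def curPos : NExp := .get 4 (.get 5 (.lit 0))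

/-- Write the absolute value of the current coordinate of the array `5` into the scratch cell. -/
def absCur : Cmd := setAbs (.lit 1) (.get 5 curPos) (.get 5 curPos)

/-- Read the update. -/
def readUpdate (p : ℕ) : Cmd :=
  forLoop 0 (.get 3 (.lit 0)) <|
  .seq absCur <|
  .seq (.setR 6 (.lit 0) (.sub (.get 6 (.lit 0)) ((RExp.get 6 (.lit 1)).pow p))) <|
  .seq (accum 5 curPos (.get 3 (.get 5 (.lit 0)))) <|
  .seq absCur <|
  .seq (accum 6 (.lit 0) ((RExp.get 6 (.lit 1)).pow p)) (incr 5 0)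

/-- Draw a coordinate of the collected update, and add a multiple of the column to the output. -/
def kernelOne : Cmd :=
  .seq (.draw 5 (.lit 3) 1) <|
  .seq (setAbs (.lit 1) (.get 5 (.get 5 (.lit 3)))
    (.div (.get 6 (.lit 0)) (.ofNat (.get 5 (.lit 2))))) <|
  forLoop 4 (.get 0 (.lit 0)) <|
  .seq (accum 4 (.get 5 (.lit 4)) (.mul (.get 6 (.lit 1))
    (.get 7 (.add (.mul (.get 5 (.lit 4)) (.get 0 (.lit 1))) (.get 5 (.lit 3))))))
    (incr 5 4)

/-- The truncation threshold. -/
def truncExp : RExp :=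
  .mul (.lit 8) (.mul (.get 0 (.lit 0)) (.mul (.ofNat (.get 5 (.lit 1))) (.ofNat (.get 0 (.lit 0)))))

/-- Draw an entry of the matrix, and change the output in its row. -/
def kernelTwo : Cmd :=
  .seq (.draw 5 (.lit 3) 0) <|
  .seq (.setR 6 (.lit 1) (.div (.mul (.get 8 (.lit 1)) (.get 5 (.get 2 (.get 5 (.lit 3)))))
    (.get 1 (.get 5 (.lit 3))))) <|
  .ite (.and (.rle (.get 6 (.lit 1)) truncExp) (.rle (.sub (.lit 0) (.get 6 (.lit 1))) truncExp))
    (accum 4 (.get 1 (.get 5 (.lit 3))) (.div (.get 6 (.lit 1)) (.ofNat (.get 5 (.lit 2)))))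
    .skip

/-- The number of draws. -/
def drawCount (p : ℕ) : NExp :=
  if p = 1 then .mul (.get 5 (.lit 1)) (.get 6 (.lit 0))
  else .mul (.get 0 (.lit 0)) (.mul (.get 5 (.lit 1)) (.get 6 (.lit 0)))

def kernel (p : ℕ) : Cmd := if p = 1 then kernelOne else kernelTwo

/-- Compute the least `m` for which the collected update has norm at most `m * (ε / 2)`. -/
def findM (p : ℕ) : Cmd :=
  .seq (.setN 5 (.lit 1) (.lit 0)) <|
  .loop (.not (.rle (.get 6 (.lit 0))
    (.mul ((RExp.ofNat (.get 5 (.lit 1))).pow p) (.get 8 (.lit 0))))) (incr 5 1)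

def clearD : Cmd :=
  .seq (forLoop 0 (.get 0 (.lit 1)) (.seq (.setR 5 (.get 5 (.lit 0)) (.lit 0)) (incr 5 0)))
    (.setR 6 (.lit 0) (.lit 0))

/-- Add an estimate of `A` times the collected update to the output, and clear the latter. -/
def rebuild (p : ℕ) : Cmd :=
  .seq (.prep 1 5 (.get 0 (.lit 1))) <| .seq (findM p) <| .seq (.setN 5 (.lit 2) (drawCount p)) <|
  .seq (forLoop 0 (.get 5 (.lit 2)) (.seq (incr 5 0) (kernel p))) clearD

/-- The test compares p-th powers, so that no roots have to be computed. -/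
def queryProg (p : ℕ) : Cmd :=
  .seq (readUpdate p) (.ite (.rle (.get 8 (.lit 0)) (.get 6 (.lit 0))) (rebuild p) .skip)

/-! ### The static part of the memory -/

/-- The rows of the nonzero entries. -/
noncomputable def rowAt {n d : ℕ} (A : Matrix (Fin n) (Fin d) ℝ) : ℕ → ℕ :=
  arrayOf ((matSupport A).map fun q => (q.1 : ℕ))

/-- The columns of the nonzero entries. -/
noncomputable def colAt {n d : ℕ} (A : Matrix (Fin n) (Fin d) ℝ) : ℕ → ℕ :=
  arrayOf ((matSupport A).map fun q => (q.2 : ℕ))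

/-- The nonzero entries. -/
noncomputable def valAt {n d : ℕ} (A : Matrix (Fin n) (Fin d) ℝ) : ℕ → ℝ :=
  arrayOf ((matSupport A).map fun q => A q.1 q.2)

/-- The square of the Frobenius norm. -/
noncomputable def frobSq {n d : ℕ} (A : Matrix (Fin n) (Fin d) ℝ) : ℝ := ∑ i, ∑ j, A i j ^ 2

/-- What `init` leaves in the memory and `query` does not change. -/
structure Static {n d : ℕ} (A : Matrix (Fin n) (Fin d) ℝ) (R E : ℝ) (K : ℕ) (s : Store) : Prop where
  n_eq : s.nat 0 0 = n
  d_eq : s.nat 0 1 = d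
  row_eq : ∀ q, s.nat 1 q = rowAt A q
  col_eq : ∀ q, s.nat 2 q = colAt A q
  K_eq : s.nat 6 0 = K
  R_eq : s.real 0 0 = R
  val_eq : ∀ q, s.real 1 q = valAt A q
  dense_eq : ∀ (i : Fin n) (j : Fin d), s.real 7 (i * d + j) = A i j
  E_eq : s.real 8 0 = E
  frob_eq : s.real 8 1 = frobSq A
  smp_eq : s.smp 0 = sampleLaw (matSupport A).length fun q => valAt A q ^ 2

section

variable {n d : ℕ} {A : Matrix (Fin n) (Fin d) ℝ} {R E : ℝ} {K : ℕ} {s : Store}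

theorem Static.putN (h : Static A R E K s) {a : ℕ} (i v : ℕ) (ha : a = 3 ∨ a = 4 ∨ a = 5) :
    Static A R E K (s.putN a i v) := by
  obtain ⟨h1, h2, h3, h4, h5, h6, h7, h8, h9, h10, h11⟩ := h
  constructor <;> rcases ha with rfl | rfl | rfl <;> simpa

theorem Static.putR (h : Static A R E K s) {a : ℕ} (i : ℕ) (v : ℝ)
    (ha : a = 3 ∨ a = 4 ∨ a = 5 ∨ a = 6) : Static A R E K (s.putR a i v) := by
  obtain ⟨h1, h2, h3, h4, h5, h6, h7, h8, h9, h10, h11⟩ := h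
  constructor <;> rcases ha with rfl | rfl | rfl | rfl <;> simpa

theorem Static.prepare (h : Static A R E K s) (a m : ℕ) : Static A R E K (s.prepare 1 a m) := by
  obtain ⟨h1, h2, h3, h4, h5, h6, h7, h8, h9, h10, h11⟩ := h
  constructor <;> simpa

theorem Static.feed (h : Static A R E K s) {d' : ℕ} (v : Fin d' → ℝ) :
    Static A R E K (s.feed v) := by
  obtain ⟨h1, h2, h3, h4, h5, h6, h7, h8, h9, h10, h11⟩ := h
  constructor <;> simpa [Store.feed]

end

/-- A vector followed by zeros. -/
noncomputable def extend {d : ℕ} (v : Fin d → ℝ) (j : ℕ) : ℝ := if h : j < d then v ⟨j, h⟩ else 0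

@[simp] theorem extend_val {d : ℕ} (v : Fin d → ℝ) (j : Fin d) : extend v j = v j := by
  simp [extend]

/-- The `p`-th power of the `ℓ_p` norm. -/
noncomputable def powSum (p : ℕ) {d : ℕ} (v : Fin d → ℝ) : ℝ := ∑ j, |v j| ^ p

/-- The invariant of the data structure, where `D` is the sum of the updates since the last
rebuild. -/
structure Inv (p : ℕ) {n d : ℕ} (A : Matrix (Fin n) (Fin d) ℝ) (R E : ℝ) (K : ℕ) (D : Fin d → ℝ)
    (s : Store) : Prop where
  static : Static A R E K s
  D_eq : ∀ j, s.real 5 j = extend D j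
  S_eq : s.real 6 0 = powSum p D

theorem Inv.feed {p n d : ℕ} {A : Matrix (Fin n) (Fin d) ℝ} {R E : ℝ} {K : ℕ} {D : Fin d → ℝ}
    {s : Store} (h : Inv p A R E K D s) (v : Fin d → ℝ) : Inv p A R E K D (s.feed v) :=
  ⟨h.static.feed v, by simpa [Store.feed] using h.D_eq, by simpa [Store.feed] using h.S_eq⟩

/-! ### Loops with a counter -/

/-- The rule for `forLoop`. -/
theorem RunsE.forLoop {i : ℕ} {e : NExp} {c : Cmd} {s : Store} {t N : ℕ} (I : ℕ → Store → Prop)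
    (F : ℕ → Store → ℝ≥0∞) {B : ℝ≥0∞} (h0 : I 0 (s.putN 5 i 0)) (hB : F 0 (s.putN 5 i 0) ≤ B)
    (hk : ∀ k s', I k s' → s'.nat 5 i = k ∧ e.eval s' = N)
    (hstep : ∀ k < N, ∀ s', I k s' → RunsE c s' t (I (k + 1)) (F (k + 1)) (F k s')) :
    RunsE (forLoop i e c) s (N * (t + 1) + 2) (I N) (F N) B := by
  refine (RunsE.setN_seq ((RunsE.loop I F h0 (fun k hkN s' hs => ⟨?_, hstep k hkN s' hs⟩)
    fun s' hs => ?_).mono le_rfl (fun _ h => h) (fun _ _ => le_rfl) hB)).mono (by omega)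
    (fun _ h => h) (fun _ _ => le_rfl) le_rfl
  · obtain ⟨h1, h2⟩ := hk k s' hs
    simp only [BExp.holds, NExp.eval, h1, h2]
    exact hkN
  · obtain ⟨h1, h2⟩ := hk N s' hs
    simp only [BExp.holds, NExp.eval, h1, h2]
    omega

theorem Runs.forLoop {i : ℕ} {e : NExp} {c : Cmd} {s : Store} {t N : ℕ} (I : ℕ → Store → Prop)
    (h0 : I 0 (s.putN 5 i 0)) (hk : ∀ k s', I k s' → s'.nat 5 i = k ∧ e.eval s' = N)
    (hstep : ∀ k < N, ∀ s', I k s' → Runs c s' t (I (k + 1))) :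
    Runs (forLoop i e c) s (N * (t + 1) + 2) (I N) :=
  RunsE.forLoop I (fun _ _ => 0) h0 le_rfl hk hstep

/-- Search for the least natural number with a property, by trial. -/
theorem Runs.search {b : BExp} {c : Cmd} {s : Store} {t N : ℕ} (I : ℕ → Store → Prop) (P : ℕ → Prop)
    (h0 : I 0 s) (hb : ∀ k s', I k s' → (b.holds s' ↔ P k))
    (hP : ∀ k < N, ¬ P k) (hN : P N)
    (hstep : ∀ k < N, ∀ s', I k s' → Runs c s' t (I (k + 1))) :
    Runs (.loop (.not b) c) s (N * (t + 1) + 1) (I N) :=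
  Runs.loop I h0 (fun k hk s' hs => ⟨fun h => hP k hk ((hb k s' hs).1 h), hstep k hk s' hs⟩)
    fun s' hs h => h ((hb N s' hs).2 hN)

theorem Runs.setAbs {s : Store} {i : NExp} {e f : RExp} {Q : Store → Prop}
    (h : Q (s.putR 6 (i.eval s) (if 0 ≤ e.eval s then f.eval s else -f.eval s))) :
    Runs (setAbs i e f) s 2 Q := by
  refine RunsE.ite (t := 1) (fun hb => Runs.setR ?_) (fun hb => Runs.setR ?_) <;>
    simp only [BExp.holds, RExp.eval, Rat.cast_zero, zero_sub] at hb ⊢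
  · rwa [if_pos hb] at h
  · rwa [if_neg hb] at h

theorem RunsE.setAbs_seq {s : Store} {t : ℕ} {i : NExp} {e f : RExp} {c : Cmd} {Q : Store → Prop}
    {F : Store → ℝ≥0∞} {B : ℝ≥0∞} (h : RunsE c
      (s.putR 6 (i.eval s) (if 0 ≤ e.eval s then f.eval s else -f.eval s)) t Q F B) :
    RunsE (.seq (setAbs i e f) c) s (2 + t) Q F B :=
  (Runs.setAbs (Q := fun s' => s' = _) rfl).seqE fun s' hs => by subst hs; exact h

/-! ### Lists of nonzero entries -/

theorem nodup_matSupport {n d : ℕ} (A : Matrix (Fin n) (Fin d) ℝ) : (matSupport A).Nodup :=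
  ((List.nodup_finRange n).product (List.nodup_finRange d)).filter _

theorem mem_matSupport {n d : ℕ} {A : Matrix (Fin n) (Fin d) ℝ} {q : Fin n × Fin d} :
    q ∈ matSupport A ↔ A q.1 q.2 ≠ 0 := by
  have : q ∈ List.finRange n ×ˢ List.finRange d :=
    List.mem_product.2 ⟨List.mem_finRange _, List.mem_finRange _⟩
  simp [matSupport, this]

theorem length_matSupport {n d : ℕ} (A : Matrix (Fin n) (Fin d) ℝ) :
    (matSupport A).length = nnzMat A := by
  rw [← List.toFinset_card_of_nodup (nodup_matSupport A), nnzMat]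
  congr 1
  ext q
  simp [mem_matSupport]

theorem nodup_vecSupport {d : ℕ} (v : Fin d → ℝ) : (vecSupport v).Nodup :=
  (List.nodup_finRange d).filter _

theorem mem_vecSupport {d : ℕ} {v : Fin d → ℝ} {j : Fin d} : j ∈ vecSupport v ↔ v j ≠ 0 := by
  simp [vecSupport]

theorem length_vecSupport_le {d : ℕ} (v : Fin d → ℝ) : (vecSupport v).length ≤ nnzVec v := by
  rw [← List.toFinset_card_of_nodup (nodup_vecSupport v), nnzVec]
  refine le_max_of_le_right (le_of_eq ?_)
  congr 1
  ext q
  simp [mem_vecSupport]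

theorem arrayOf_map {α β : Type*} [Zero β] {l : List α} (f : α → β) {k : ℕ} (hk : k < l.length) :
    arrayOf (l.map f) k = f l[k] := by
  simp [arrayOf, hk]

section

variable {n d : ℕ} (A : Matrix (Fin n) (Fin d) ℝ)

theorem rowAt_eq {q : ℕ} (hq : q < (matSupport A).length) :
    rowAt A q = ((matSupport A)[q].1 : ℕ) := arrayOf_map _ hq

theorem colAt_eq {q : ℕ} (hq : q < (matSupport A).length) :
    colAt A q = ((matSupport A)[q].2 : ℕ) := arrayOf_map _ hq

theorem valAt_eq {q : ℕ} (hq : q < (matSupport A).length) :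
    valAt A q = A (matSupport A)[q].1 (matSupport A)[q].2 := arrayOf_map _ hq

theorem valAt_ne_zero {q : ℕ} (hq : q < (matSupport A).length) : valAt A q ≠ 0 := by
  rw [valAt_eq A hq]
  exact mem_matSupport.1 (List.getElem_mem hq)

/-- Sums over the list of nonzero entries. -/
theorem sum_matSupport (φ : ℕ → ℕ → ℝ → ℝ) (h : ∀ i j, φ i j 0 = 0) :
    ∑ q ∈ Finset.range (matSupport A).length, φ (rowAt A q) (colAt A q) (valAt A q) =
      ∑ i : Fin n, ∑ j : Fin d, φ i j (A i j) := by
  have h1 : ∑ q ∈ Finset.range (matSupport A).length, φ (rowAt A q) (colAt A q) (valAt A q) =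
      ((matSupport A).map fun q => φ q.1 q.2 (A q.1 q.2)).sum := by
    rw [Finset.sum_range, ← Fin.sum_univ_fun_getElem]
    refine Finset.sum_congr rfl fun q _ => ?_
    rw [rowAt_eq A q.2, colAt_eq A q.2, valAt_eq A q.2]
  rw [h1, ← List.sum_toFinset _ (nodup_matSupport A), ← Fintype.sum_prod_type'
    (f := fun (i : Fin n) (j : Fin d) => φ i j (A i j))]
  refine Finset.sum_subset (Finset.subset_univ _) fun q _ hq => ?_
  rw [List.mem_toFinset, mem_matSupport, not_not] at hq
  rw [hq, h]

end

/-! ### Vectors extended by zeros, and their power sums -/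

theorem extend_zero {d : ℕ} (j : ℕ) : extend (0 : Fin d → ℝ) j = 0 := by
  simp [extend]

theorem extend_update {d : ℕ} (v : Fin d → ℝ) (j : Fin d) (x : ℝ) (k : ℕ) :
    extend (Function.update v j x) k = if k = j then x else extend v k := by
  by_cases hk : k < d
  · simp [extend, hk, Function.update_apply, Fin.ext_iff]
  · have : k ≠ j := fun h => hk (h ▸ j.2)
    simp [extend, hk, this]

theorem powSum_zero {p d : ℕ} (hp : p ≠ 0) : powSum p (0 : Fin d → ℝ) = 0 := by
  simp [powSum, hp]

/-- This lets `readUpdate` keep the norm of the collected update current at constant cost per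
received coordinate, instead of a pass over all `d` coordinates in each query. -/
theorem powSum_update (p : ℕ) {d : ℕ} (v : Fin d → ℝ) (j : Fin d) (x : ℝ) :
    powSum p (Function.update v j x) = powSum p v - |v j| ^ p + |x| ^ p := by
  rw [powSum, powSum, ← Finset.add_sum_erase _ _ (Finset.mem_univ j),
    ← Finset.add_sum_erase _ (fun j => |v j| ^ p) (Finset.mem_univ j), Function.update_self,
    Finset.sum_congr rfl fun k hk => by rw [Function.update_of_ne (Finset.ne_of_mem_erase hk)]]
  ring

/-! ### Reading the update -/

/-- `D` plus the coordinates of `v` in the list `l`. -/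
noncomputable def addOn {d : ℕ} (D v : Fin d → ℝ) (l : List (Fin d)) : Fin d → ℝ :=
  fun j => D j + if j ∈ l then v j else 0

theorem addOn_nil {d : ℕ} (D v : Fin d → ℝ) : addOn D v [] = D := by
  ext j
  simp [addOn]

theorem addOn_append {d : ℕ} {D v : Fin d → ℝ} {l : List (Fin d)} {j : Fin d} (hj : j ∉ l) :
    addOn D v (l ++ [j]) = Function.update (addOn D v l) j (addOn D v l j + v j) := by
  ext k
  by_cases hk : k = j
  · subst hk
    simp [addOn, hj]
  · simp [addOn, hk]

theorem addOn_vecSupport {d : ℕ} (D v : Fin d → ℝ) : addOn D v (vecSupport v) = D + v := by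
  ext j
  by_cases h : v j = 0 <;> simp [addOn, mem_vecSupport, h]

theorem abs_ite (x : ℝ) : (if 0 ≤ x then x else -x) = |x| := by
  split_ifs with h
  · exact (abs_of_nonneg h).symm
  · exact (abs_of_neg (not_le.1 h)).symm

theorem runs_readUpdate {p n d : ℕ} {A : Matrix (Fin n) (Fin d) ℝ} {R E : ℝ} {K : ℕ}
    {D : Fin d → ℝ} {s : Store} (h : Inv p A R E K D s) (v : Fin d → ℝ) :
    Runs (readUpdate p) (s.feed v) ((vecSupport v).length * 9 + 2) fun s' =>
      Inv p A R E K (D + v) s' ∧ ∀ i, s'.real 4 i = s.real 4 i := by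
  have h' := h.feed v
  refine (Runs.forLoop (t := 8) (N := (vecSupport v).length) (fun k s' =>
    Inv p A R E K (addOn D v ((vecSupport v).take k)) s' ∧ s'.nat 5 0 = k ∧
    (∀ q, s'.nat 3 q = arrayOf [(vecSupport v).length] q) ∧
    (∀ q, s'.nat 4 q = arrayOf ((vecSupport v).map fun j : Fin d => (j : ℕ)) q) ∧
    (∀ q, s'.real 3 q = arrayOf ((vecSupport v).map v) q) ∧
    ∀ i, s'.real 4 i = s.real 4 i) ?_ ?_ ?_).mono le_rfl ?_
  · refine ⟨⟨h'.static.putN _ _ (by simp), ?_, ?_⟩, ?_, ?_, ?_, ?_, ?_⟩ <;>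
      simp [Store.feed, h.D_eq, h.S_eq, addOn_nil, List.map_eq_flatMap]
  · rintro k s' ⟨-, h1, h2, -⟩
    exact ⟨h1, by simp [NExp.eval, h2, arrayOf]⟩
  · rintro k hk s' ⟨⟨hs, hD, hS⟩, hc, h3, h4, h5, h6⟩
    have e4 := h4 k
    have e5 := h5 k
    rw [arrayOf_map _ hk] at e4 e5
    set j := (vecSupport v)[k] with hj
    -- Each coordinate is listed once, so cell `j` has not yet received its summand.
    have hmem : j ∉ (vecSupport v).take k := by
      have h1 : ((vecSupport v).take (k + 1)).Nodup := (nodup_vecSupport v).sublist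
        (List.take_sublist _ _)
      rw [List.take_add_one, List.getElem?_eq_getElem hk, Option.toList_some] at h1
      exact (List.disjoint_of_nodup_append h1).symm (by simp [hj])
    have hnext : addOn D v ((vecSupport v).take (k + 1)) = Function.update
        (addOn D v ((vecSupport v).take k)) j (addOn D v ((vecSupport v).take k) j + v j) := by
      rw [← addOn_append hmem, List.take_add_one, List.getElem?_eq_getElem hk, Option.toList_some]
    rw [hnext]
    refine show RunsE _ _ (2 + (1 + (1 + (2 + (1 + 1))))) _ _ _ from
      .setAbs_seq <| .setR_seq <| .setR_seq <| .setAbs_seq <| .setR_seq <| Runs.setN ?_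
    refine ⟨⟨?_, ?_, ?_⟩, ?_, ?_, ?_, ?_, ?_⟩
    · exact (((((hs.putR _ _ (by simp)).putR _ _ (by simp)).putR _ _ (by simp)).putR _ _
        (by simp)).putR _ _ (by simp)).putN _ _ (by simp)
    · intro q
      simp [NExp.eval, RExp.eval, curPos, hc, e4, e5, extend_update, hD]
    · simp [NExp.eval, RExp.eval, curPos, hc, e4, e5, powSum_update, hD, hS, abs_ite, -neg_add_rev]
    · simp [NExp.eval, hc]
    · simpa using h3
    · simpa using h4
    · simpa using h5
    · simpa using h6
  · rintro s' ⟨h1, -, -, -, -, h2⟩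
    rw [List.take_length, addOn_vecSupport] at h1
    exact ⟨h1, h2⟩

theorem runs_clearD {p n d : ℕ} (hp : p ≠ 0) {A : Matrix (Fin n) (Fin d) ℝ} {R E : ℝ} {K : ℕ}
    {D : Fin d → ℝ} {s : Store} (h : Inv p A R E K D s) :
    Runs clearD s (d * 3 + 3) fun s' =>
      Inv p A R E K 0 s' ∧ ∀ i, s'.real 4 i = s.real 4 i := by
  refine Runs.seq (Runs.forLoop (t := 2) (N := d) (fun k s' => Static A R E K s' ∧
    s'.nat 5 0 = k ∧ (∀ j, s'.real 5 j = if j < k then 0 else extend D j) ∧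
    ∀ i, s'.real 4 i = s.real 4 i) ?_ ?_ ?_) (t₂ := 1) ?_
  · refine ⟨h.static.putN _ _ (by simp), ?_, ?_, ?_⟩ <;> simp [h.D_eq]
  · rintro k s' ⟨h1, h2, -⟩
    exact ⟨h2, by simp [NExp.eval, h1.d_eq]⟩
  · rintro k hk s' ⟨h1, h2, h3, h4⟩
    refine RunsE.setR_seq <| Runs.setN ⟨(h1.putR _ _ (by simp)).putN _ _ (by simp), ?_, ?_, ?_⟩
    · simp [NExp.eval, h2]
    · intro j
      simp only [NExp.eval, RExp.eval, h2, Store.putN_real, Store.putR_real, h3, true_and,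
        Rat.cast_zero]
      split_ifs <;> first | rfl | omega
    · simpa using h4
  · rintro s' ⟨h1, h2, h3, h4⟩
    refine Runs.setR ⟨⟨h1.putR _ _ (by simp), ?_, ?_⟩, ?_⟩
    · intro j
      by_cases hj : j < d <;> simp [NExp.eval, h3, hj, extend]
    · simp [NExp.eval, RExp.eval, powSum_zero hp]
    · simpa using h4

/-! ### Initialization -/

/-- The memory during the initialization, after `k` entries of the matrix have been read. -/
structure InitInv {n d : ℕ} (A : Matrix (Fin n) (Fin d) ℝ) (x₀ : Fin d → ℝ) (R ε δ : ℝ)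
    (L K k : ℕ) (s : Store) : Prop where
  n_eq : s.nat 0 0 = n
  d_eq : s.nat 0 1 = d
  nnz_eq : s.nat 0 2 = (matSupport A).length
  row_eq : ∀ q, s.nat 1 q = rowAt A q
  col_eq : ∀ q, s.nat 2 q = colAt A q
  L_eq : s.nat 5 1 = L
  K_eq : s.nat 6 0 = K
  R_eq : s.real 0 0 = R
  ε_eq : s.real 0 1 = ε
  δ_eq : s.real 0 2 = δ
  val_eq : ∀ q, s.real 1 q = valAt A q
  x_eq : ∀ j, s.real 2 j = extend x₀ j
  y_eq : ∀ i, s.real 4 i = ∑ q ∈ Finset.range k,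
    if rowAt A q = i then valAt A q * extend x₀ (colAt A q) else 0
  D_eq : ∀ j, s.real 5 j = 0
  S_eq : s.real 6 0 = 0
  dense_eq : ∀ (i : Fin n) (j : Fin d),
    s.real 7 (i * d + j) = if (i, j) ∈ (matSupport A).take k then A i j else 0
  frob_eq : s.real 8 1 = ∑ q ∈ Finset.range k, valAt A q ^ 2
  sq_eq : ∀ q, s.real 9 q = if q < k then valAt A q ^ 2 else 0

section

variable {n d : ℕ} {A : Matrix (Fin n) (Fin d) ℝ} {x₀ : Fin d → ℝ} {R ε δ : ℝ} {L K : ℕ}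

theorem arrayOf_ofFn (v : Fin d → ℝ) (j : ℕ) : arrayOf (List.ofFn v) j = extend v j := by
  by_cases h : j < d <;> simp [arrayOf, extend, h]

theorem initInv_inputStore : InitInv A x₀ R ε δ 0 0 0 (inputStore A x₀ R ε δ) := by
  constructor <;> simp [inputStore, rowAt, colAt, valAt, arrayOf_ofFn] <;> simp [arrayOf]

theorem runs_initL {s : Store} (h : InitInv A x₀ R ε δ 0 0 0 s)
    (hL : ∀ k < L, 2 ^ k * (ε * δ) < n * R) (hL' : n * R ≤ 2 ^ L * (ε * δ)) :
    Runs initL s (L * 3 + 2) (InitInv A x₀ R ε δ L 0 0) := by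
  have h1 : Runs initL s (1 + (L * (2 + 1) + 1)) fun s' =>
      InitInv A x₀ R ε δ L 0 0 s' ∧ s'.real 6 2 = 2 ^ L := by
    refine RunsE.setR_seq (Runs.search (t := 2) (N := L)
      (fun k s' => InitInv A x₀ R ε δ k 0 0 s' ∧ s'.real 6 2 = 2 ^ k)
      (fun k => n * R ≤ 2 ^ k * (ε * δ)) ?_ ?_ (fun k hk => not_le.2 (hL k hk)) hL' ?_)
    · obtain ⟨_, _, _, _, _, _, _, _, _, _, _, _, _, _, _, _, _, _⟩ := h
      constructor
      · constructor <;> simp [NExp.eval] <;> assumption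
      · simp [NExp.eval, RExp.eval]
    · rintro k s' ⟨h1, h2⟩
      simp [BExp.holds, NExp.eval, RExp.eval, h1.n_eq, h1.R_eq, h1.ε_eq, h1.δ_eq, h2]
    · rintro k - s' ⟨h1, h2⟩
      obtain ⟨_, _, _, _, _, _, _, _, _, _, _, _, _, _, _, _, _, _⟩ := h1
      refine RunsE.setR_seq <| Runs.setN ⟨?_, ?_⟩
      · constructor <;> simp [NExp.eval] <;> assumption
      · simp only [NExp.eval, RExp.eval, Store.putN_real, Store.putR_real, h2, and_self, if_true]
        ring
  exact h1.mono (by omega) fun _ h => h.1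

theorem runs_initK {s : Store} (h : InitInv A x₀ R ε δ L 0 0 s)
    (hK : ∀ k < K, k * ε < 64 * (R * L)) (hK' : 64 * (R * L) ≤ K * ε) :
    Runs initK s (K * 2 + 1) (InitInv A x₀ R ε δ L K 0) := by
  refine Runs.search (t := 1) (N := K)
    (fun k s' => InitInv A x₀ R ε δ L k 0 s')
    (fun k => 64 * (R * L) ≤ k * ε) h ?_ (fun k hk => not_le.2 (hK k hk)) hK' ?_
  · rintro k s' h1
    simp [BExp.holds, NExp.eval, RExp.eval, h1.L_eq, h1.R_eq, h1.ε_eq, h1.K_eq]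
  · rintro k - s' h1
    obtain ⟨_, _, _, _, _, _, _, _, _, _, _, _, _, _, _, _, _, _⟩ := h1
    refine Runs.setN ?_
    constructor <;> simp [NExp.eval] <;> assumption

/-- Row-major addresses do not collide, so writing one entry of the dense copy leaves the others
intact. -/
theorem mul_add_inj {d i j i' j' : ℕ} (hj : j < d) (hj' : j' < d) :
    i * d + j = i' * d + j' ↔ i = i' ∧ j = j' := by
  constructor
  · intro h
    have hd : 0 < d := by omega
    have h1 : (i * d + j) / d = i := by
      rw [mul_comm, Nat.mul_add_div hd, Nat.div_eq_of_lt hj, add_zero]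
    have h2 : (i' * d + j') / d = i' := by
      rw [mul_comm, Nat.mul_add_div hd, Nat.div_eq_of_lt hj', add_zero]
    have h3 : i = i' := by rw [← h1, ← h2, h]
    subst h3
    exact ⟨rfl, by omega⟩
  · rintro ⟨rfl, rfl⟩
    rfl

theorem runs_initA {s : Store} (h : InitInv A x₀ R ε δ L K 0 s) :
    Runs initA s ((matSupport A).length * 6 + 2)
      (InitInv A x₀ R ε δ L K (matSupport A).length) := by
  refine (Runs.forLoop (t := 5) (N := (matSupport A).length)
    (fun k s' => InitInv A x₀ R ε δ L K k s' ∧ s'.nat 5 0 = k) ?_ ?_ ?_).mono le_rfl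
    fun _ h => h.1
  · obtain ⟨_, _, _, _, _, _, _, _, _, _, _, _, _, _, _, _, _, _⟩ := h
    constructor
    · constructor <;> simp <;> assumption
    · simp
  · rintro k s' ⟨h1, h2⟩
    exact ⟨h2, by simp [NExp.eval, h1.nnz_eq]⟩
  · rintro k hk s' ⟨h1, h2⟩
    obtain ⟨a1, a2, a3, a4, a5, a6, a7, a8, a9, a10, a11, a12, a13, a14, a15, a16, a17, a18⟩ := h1
    refine show RunsE _ _ (1 + (1 + (1 + (1 + 1)))) _ _ _ from
      .setR_seq <| .setR_seq <| .setR_seq <| .setR_seq <| Runs.setN ⟨?_, ?_⟩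
    · simp only [NExp.eval, RExp.eval, Store.putR_nat, Store.putR_real, h2, a2, a4, a5, a11]
      constructor <;> try (simpa using by assumption)
      · intro i
        rw [Finset.sum_range_succ, ← a13 i]
        by_cases hi : rowAt A k = i
        · subst hi
          simp [a12]
        · simp [hi, Ne.symm hi]
      · intro i j
        simp only [Store.putN_real, Store.putR_real, true_and, rowAt_eq A hk, colAt_eq A hk,
          mul_add_inj j.2 (Fin.is_lt _), valAt_eq A hk, a16 i j, List.take_add_one,
          List.getElem?_eq_getElem hk, Option.toList_some, List.mem_append, List.mem_singleton,
          Prod.ext_iff, Fin.ext_iff]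
        by_cases hq : (i : ℕ) = (matSupport A)[k].1 ∧ (j : ℕ) = (matSupport A)[k].2
        · have e1 : i = (matSupport A)[k].1 := Fin.ext hq.1
          have e2 : j = (matSupport A)[k].2 := Fin.ext hq.2
          simp [← e1, ← e2]
        · simp [hq]
      · simp [Finset.sum_range_succ, a17, pow_two]
      · intro q
        rcases lt_trichotomy q k with hq | rfl | hq
        · simp [hq.ne, a18 q, hq, Nat.lt_succ_of_lt hq]
        · simp [pow_two]
        · simp [hq.ne', a18 q, hq.not_gt, not_le.2 hq]
    · simp [NExp.eval, h2]

theorem runs_initProg {p : ℕ} (hp : p ≠ 0)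
    (hL : ∀ k < L, 2 ^ k * (ε * δ) < n * R) (hL' : n * R ≤ 2 ^ L * (ε * δ))
    (hK : ∀ k < K, k * ε < 64 * (R * L)) (hK' : 64 * (R * L) ≤ K * ε) :
    Runs (initProg p) (inputStore A x₀ R ε δ) (3 * L + 2 * K + 7 * (matSupport A).length + 7)
      fun s => Inv p A R ((ε / 2) ^ p) K 0 s ∧ ∀ i : Fin n, s.real 4 i = A.mulVec x₀ i := by
  refine RunsE.mono (t := L * 3 + 2 + (K * 2 + 1 + ((matSupport A).length * 6 + 2 +
    ((matSupport A).length + 1 + 1)))) ?_ (by omega) (fun _ h => h) (fun _ _ => le_rfl) le_rfl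
  refine Runs.seq (runs_initL initInv_inputStore hL hL') fun s₁ h₁ => ?_
  refine Runs.seq (runs_initK h₁ hK hK') fun s₂ h₂ => ?_
  refine Runs.seq (runs_initA h₂) fun s₃ h₃ => ?_
  obtain ⟨a1, a2, a3, a4, a5, a6, a7, a8, a9, a10, a11, a12, a13, a14, a15, a16, a17, a18⟩ := h₃
  refine Runs.seq (t₁ := (matSupport A).length + 1) (Q₁ := fun s' => s' = s₃.prepare 0 9
    (matSupport A).length) ?_ fun s₄ h₄ => ?_
  · have := Runs.prep (k := 0) (a := 9) (m := .get 0 (.lit 2)) (s := s₃)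
      (Q := fun s' => s' = s₃.prepare 0 9 (matSupport A).length) (by simp [NExp.eval, a3])
    simpa [NExp.eval, a3] using this
  · subst h₄
    refine Runs.setR ⟨⟨?_, ?_, ?_⟩, ?_⟩
    · constructor
      · simpa
      · simpa
      · simpa
      · simpa
      · simpa
      · simpa
      · simpa
      · intro i j
        rw [Store.putR_real, if_neg (by simp), Store.prepare_real, a16, List.take_length]
        by_cases hij : A i j = 0 <;> simp [mem_matSupport, hij]
      · simp [NExp.eval, RExp.eval, a9]
      · simp only [NExp.eval, Store.putR_real, Store.prepare_real, a17]
        rw [if_neg (by simp)]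
        exact sum_matSupport A (fun _ _ x => x ^ 2) (by simp)
      · simp only [Store.putR_smp, Store.prepare_smp, if_true]
        congr 1
        -- Beyond the list of nonzero entries both weight functions vanish.
        ext q
        rw [a18 q]
        split_ifs with hq
        · rfl
        · simp [valAt, arrayOf, not_lt.1 hq]
    · intro j
      simp [a14, extend_zero]
    · simp [a15, powSum_zero hp]
    · intro i
      simp only [Store.putR_real, Store.prepare_real, a13]
      rw [if_neg (by simp), sum_matSupport A (fun r c x => if r = i then x * extend x₀ c else 0)
        (by simp), Finset.sum_eq_single i]
      · simp [Matrix.mulVec, dotProduct]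
      · intro b _ hb
        simp [Fin.val_ne_of_ne hb]
      · simp

end

/-! ### Rebuilding -/

/-- The memory during a rebuild, with `m` parts and `J` draws, when the counter is `c`. -/
structure RebuildInv (p : ℕ) {n d : ℕ} (A : Matrix (Fin n) (Fin d) ℝ) (R E : ℝ) (K : ℕ)
    (D : Fin d → ℝ) (m J c : ℕ) (s : Store) : Prop where
  inv : Inv p A R E K D s
  smp_eq : s.smp 1 = sampleLaw d (extend D)
  m_eq : s.nat 5 1 = m
  J_eq : s.nat 5 2 = J
  c_eq : s.nat 5 0 = c

section

variable {p n d : ℕ} {A : Matrix (Fin n) (Fin d) ℝ} {R E : ℝ} {K : ℕ} {D : Fin d → ℝ}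
  {m J c : ℕ} {s : Store}

theorem Inv.putN (h : Inv p A R E K D s) {a : ℕ} (i v : ℕ) (ha : a = 3 ∨ a = 4 ∨ a = 5) :
    Inv p A R E K D (s.putN a i v) :=
  ⟨h.static.putN i v ha, h.D_eq, h.S_eq⟩

theorem Inv.putR_output (h : Inv p A R E K D s) (i : ℕ) (v : ℝ) :
    Inv p A R E K D (s.putR 4 i v) :=
  ⟨h.static.putR i v (by simp), by simpa using h.D_eq, by simpa using h.S_eq⟩

theorem Inv.putR_scratch (h : Inv p A R E K D s) (i : ℕ) (v : ℝ) (hi : i ≠ 0) :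
    Inv p A R E K D (s.putR 6 i v) :=
  ⟨h.static.putR i v (by simp), by simpa using h.D_eq, by simpa [hi.symm] using h.S_eq⟩

theorem Inv.prepare (h : Inv p A R E K D s) (a k : ℕ) : Inv p A R E K D (s.prepare 1 a k) :=
  ⟨h.static.prepare a k, h.D_eq, h.S_eq⟩

theorem RebuildInv.putN (h : RebuildInv p A R E K D m J c s) {i : ℕ} (v : ℕ) (hi : 3 ≤ i) :
    RebuildInv p A R E K D m J c (s.putN 5 i v) := by
  obtain ⟨h1, h2, h3, h4, h5⟩ := h
  refine ⟨h1.putN i v (by simp), h2, ?_, ?_, ?_⟩ <;> rw [Store.putN_nat, if_neg (by omega)] <;>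
    assumption

theorem RebuildInv.putR_output (h : RebuildInv p A R E K D m J c s) (i : ℕ) (v : ℝ) :
    RebuildInv p A R E K D m J c (s.putR 4 i v) :=
  ⟨h.inv.putR_output i v, h.smp_eq, h.m_eq, h.J_eq, h.c_eq⟩

theorem RebuildInv.putR_scratch (h : RebuildInv p A R E K D m J c s) (i : ℕ) (v : ℝ) (hi : i ≠ 0) :
    RebuildInv p A R E K D m J c (s.putR 6 i v) :=
  ⟨h.inv.putR_scratch i v hi, h.smp_eq, h.m_eq, h.J_eq, h.c_eq⟩

/-- The change of the output when the coordinate `v` is drawn. -/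
noncomputable def changeOne (A : Matrix (Fin n) (Fin d) ℝ) (D : Fin d → ℝ) (J v : ℕ) (i : Fin n) :
    ℝ :=
  (if 0 ≤ extend D v then powSum 1 D / J else -(powSum 1 D / J)) * extend (A i) v

/-- The function `g` of the output is arbitrary so that `runs_rebuild` can insert the potential.
`hD` guarantees that the drawn index is less than `d`, so that the computed address lies in the
intended row of the dense matrix. -/
theorem runs_kernelOne (hD : powSum 1 D ≠ 0) (h : RebuildInv 1 A R E K D m J c s)
    (g : (Fin n → ℝ) → ℝ) :
    RunsE kernelOne s (n * 3 + 5) (RebuildInv 1 A R E K D m J c)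
      (fun s' => ENNReal.ofReal (g fun i => s'.real 4 i))
      (expect (sampleLaw d (extend D)) fun v =>
        ENNReal.ofReal (g fun i => s.real 4 i + changeOne A D J v i)) := by
  have hW : ∑ j ∈ Finset.range d, |extend D j| ≠ 0 := by
    rw [Finset.sum_range]
    simpa [powSum] using hD
  refine (show RunsE _ _ (1 + (2 + (n * (2 + 1) + 2))) _ _ _ from RunsE.draw_seq
    (fun v => ENNReal.ofReal (g fun i => s.real 4 i + changeOne A D J v i)) fun v hv =>
      .setAbs_seq ?_).mono (by omega) (fun _ h => h) (fun _ _ => le_rfl) (by rw [h.smp_eq])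
  rw [h.smp_eq] at hv
  have hvd := lt_of_mem_support_sampleLaw hW hv
  set w : ℝ := if 0 ≤ extend D v then powSum 1 D / J else -(powSum 1 D / J) with hw
  refine (Runs.forLoop (t := 2) (N := n) (fun k s' => RebuildInv 1 A R E K D m J c s' ∧
    s'.nat 5 3 = v ∧ s'.nat 5 4 = k ∧ s'.real 6 1 = w ∧
    ∀ i : Fin n, s'.real 4 i = if (i : ℕ) < k then s.real 4 i + changeOne A D J v i
      else s.real 4 i) ?_ ?_ ?_).toRunsE (fun s' h' => ?_) |>.mono le_rfl (fun _ h => h.1)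
      (fun _ _ => le_rfl) le_rfl
  · refine ⟨((h.putN _ (by simp [NExp.eval])).putR_scratch _ _ (by simp [NExp.eval])).putN _
      (by norm_num), ?_, ?_, ?_, ?_⟩
    · simp [NExp.eval]
    · simp
    · simp [NExp.eval, RExp.eval, h.inv.D_eq, h.inv.S_eq, h.J_eq, hw]
    · simp
  · rintro k s' ⟨h1, -, h2, -⟩
    exact ⟨h2, by simp [NExp.eval, h1.inv.static.n_eq]⟩
  · rintro k hk s' ⟨h1, h2, h3, h4, h5⟩
    refine RunsE.setR_seq <| Runs.setN ⟨(h1.putR_output _ _).putN _ (by norm_num [NExp.eval]), ?_, ?_, ?_, ?_⟩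
    · simpa [NExp.eval] using h2
    · simp [NExp.eval, h3]
    · simpa [NExp.eval] using h4
    · intro i
      have h6 := h1.inv.static.dense_eq ⟨k, hk⟩ ⟨v, hvd⟩
      have h7 := h5 ⟨k, hk⟩
      simp only [lt_irrefl, if_false] at h6 h7
      simp only [NExp.eval, RExp.eval, Store.putN_real, Store.putR_real, h2, h3, h4, true_and,
        h1.inv.static.d_eq, h6, h7, h5 i]
      rcases lt_trichotomy (i : ℕ) k with hi | hi | hi
      · rw [if_neg hi.ne, if_pos hi, if_pos (by omega)]
      · obtain rfl : i = ⟨k, hk⟩ := Fin.ext hi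
        simp [changeOne, hw, extend, hvd]
      · rw [if_neg hi.ne', if_neg hi.not_gt, if_neg (by omega)]
  · refine le_of_eq ?_
    congr 2
    ext i
    rw [h'.2.2.2.2 i, if_pos i.2]

/-- The estimate that the entry number `v` of the matrix gives. -/
noncomputable def estimate (A : Matrix (Fin n) (Fin d) ℝ) (D : Fin d → ℝ) (v : ℕ) : ℝ :=
  frobSq A * extend D (colAt A v) / valAt A v

/-- The change of the output when the entry number `v` of the matrix is drawn. -/
noncomputable def changeTwo (A : Matrix (Fin n) (Fin d) ℝ) (D : Fin d → ℝ) (θ : ℝ) (J v : ℕ)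
    (i : Fin n) : ℝ :=
  if rowAt A v = i ∧ |estimate A D v| ≤ θ then estimate A D v / J else 0

/-- Both branches of the test realize `changeTwo`, which is zero for a discarded sample. The drawn
index needs no bound, as the arrays involved are specified at every index. -/
theorem runs_kernelTwo (h : RebuildInv 2 A R E K D m J c s) (g : (Fin n → ℝ) → ℝ) :
    RunsE kernelTwo s 4 (RebuildInv 2 A R E K D m J c)
      (fun s' => ENNReal.ofReal (g fun i => s'.real 4 i))
      (expect (sampleLaw (matSupport A).length fun q => valAt A q ^ 2) fun v =>
        ENNReal.ofReal (g fun i => s.real 4 i + changeTwo A D (8 * (R * (m * n))) J v i)) := by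
  refine (show RunsE _ _ (1 + (1 + (1 + 1))) _ _ _ from RunsE.draw_seq
    (fun v => ENNReal.ofReal (g fun i => s.real 4 i + changeTwo A D (8 * (R * (m * n))) J v i))
      fun v hv => .setR_seq <| .ite ?_ ?_).mono (by omega) (fun _ h => h) (fun _ _ => le_rfl)
      (by rw [h.inv.static.smp_eq])
  all_goals
    have hS := h.inv.static
    have h0 : RebuildInv 2 A R E K D m J c ((s.putN 5 3 v).putR 6 1 (estimate A D v)) :=
      (h.putN v (by norm_num)).putR_scratch _ _ (by norm_num)
    simp only [BExp.holds, truncExp, NExp.eval, RExp.eval, Store.putR_nat, Store.putR_real,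
      Store.putN_nat, Store.putN_real, and_self, if_true, hS.frob_eq, h.inv.D_eq, hS.col_eq,
      hS.val_eq, hS.R_eq, hS.n_eq, h.m_eq]
    norm_num [h.m_eq, hS.n_eq]
    rw [← estimate]
    intro hb
  · intro hb₂
    refine (Runs.setR (Q := fun s' => RebuildInv 2 A R E K D m J c s' ∧ ∀ i : Fin n,
      s'.real 4 i = s.real 4 i + changeTwo A D (8 * (R * (m * n))) J v i) ?_).toRunsE
      (fun s' h' => ?_) |>.mono le_rfl (fun _ h => h.1) (fun _ _ => le_rfl) le_rfl
    · refine ⟨h0.putR_output _ _, fun i => ?_⟩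
      simp only [NExp.eval, RExp.eval, Store.putR_nat, Store.putR_real,
        Store.putN_nat, Store.putN_real, and_self, if_true, hS.row_eq, changeTwo]
      have hb' : |estimate A D v| ≤ 8 * (R * (m * n)) := abs_le'.2 ⟨hb, by linarith⟩
      by_cases hi : rowAt A v = i
      · simp [hi, hb', h.J_eq]
      · simp [hi, Ne.symm hi]
    · simp only [h'.2]; exact le_rfl
  · refine (Runs.skip (Q := fun s' => RebuildInv 2 A R E K D m J c s' ∧ ∀ i : Fin n,
      s'.real 4 i = s.real 4 i + changeTwo A D (8 * (R * (m * n))) J v i) ?_).toRunsE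
      (fun s' h' => ?_) |>.mono le_rfl (fun _ h => h.1) (fun _ _ => le_rfl) le_rfl
    · refine ⟨h0, fun i => ?_⟩
      have hb' : ¬ |estimate A D v| ≤ 8 * (R * (m * n)) := fun h2 =>
        absurd (hb (abs_le'.1 h2).1) (by have := (abs_le'.1 h2).2; linarith)
      simp [changeTwo, hb']
    · simp only [h'.2]; exact le_rfl

theorem runs_findM (h : RebuildInv p A R E K D m J c s) {M : ℕ}
    (hM : ∀ k < M, k ^ p * E < powSum p D) (hM' : powSum p D ≤ M ^ p * E) :
    Runs (findM p) s (M * 2 + 2) fun s' =>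
      RebuildInv p A R E K D M J c s' ∧ ∀ i, s'.real 4 i = s.real 4 i := by
  refine RunsE.mono (show RunsE _ _ (1 + (M * (1 + 1) + 1)) _ _ _ from RunsE.setN_seq
    (Runs.search (t := 1) (N := M) (fun k s' => RebuildInv p A R E K D k J c s' ∧
      ∀ i, s'.real 4 i = s.real 4 i) (fun k => powSum p D ≤ k ^ p * E) ?_ ?_
      (fun k hk => not_le.2 (hM k hk)) hM' ?_)) (by omega) (fun _ h => h) (fun _ _ => le_rfl) le_rfl
  · obtain ⟨h1, h2, h3, h4, h5⟩ := h
    exact ⟨⟨h1.putN _ _ (by simp), h2, by simp [NExp.eval], by simpa [NExp.eval],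
      by simpa [NExp.eval]⟩, by simp⟩
  · rintro k s' ⟨h1, -⟩
    simp [BExp.holds, RExp.eval, NExp.eval, h1.m_eq, h1.inv.S_eq, h1.inv.static.E_eq]
  · rintro k hk s' ⟨⟨h1, h2, h3, h4, h5⟩, h6⟩
    exact Runs.setN ⟨⟨h1.putN _ _ (by simp), h2, by simp [NExp.eval, h3], by simpa [NExp.eval],
      by simpa [NExp.eval]⟩, by simpa⟩

/-- A rebuild multiplies the potential by at most `exp (γ * J)`, if a draw multiplies it by at most
`exp γ`. -/
theorem runs_rebuild (hp : p ≠ 0) (h : Inv p A R E K D s)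
    (hM : ∀ k < m, k ^ p * E < powSum p D) (hM' : powSum p D ≤ m ^ p * E)
    (hJ : ∀ s', RebuildInv p A R E K D m (s'.nat 5 2) (s'.nat 5 0) s' → (drawCount p).eval s' = J)
    (hJ0 : J ≠ 0) {t : ℕ} (law : PMF ℕ) (f : ℕ → Fin n → ℝ)
    (hk : ∀ c s', RebuildInv p A R E K D m J c s' → ∀ g : (Fin n → ℝ) → ℝ,
      RunsE (kernel p) s' t (RebuildInv p A R E K D m J c)
        (fun s₁ => ENNReal.ofReal (g fun i => s₁.real 4 i))
        (expect law fun v => ENNReal.ofReal (g fun i => s'.real 4 i + f v i)))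
    {l γ : ℝ} {a b : Fin n → ℝ}
    (hl : ∀ e : Fin n → ℝ, expect law (fun v =>
      ENNReal.ofReal (coshSum l fun i => e i + f v i - b i / J)) ≤
        ENNReal.ofReal (Real.exp γ * coshSum l e)) :
    RunsE (rebuild p) s (4 * d + 2 * m + J * (t + 2) + 9) (Inv p A R E K 0)
      (fun s' => ENNReal.ofReal (Real.exp (-(γ * J)) *
        coshSum l fun i => s'.real 4 i - a i - b i))
      (ENNReal.ofReal (coshSum l fun i => s.real 4 i - a i)) := by
  refine RunsE.mono (t := d + 1 + (m * 2 + 2 + (1 + (J * (1 + t + 1) + 2 + (d * 3 + 3))))) ?_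
    (by ring_nf; omega) (fun _ h => h) (fun _ _ => le_rfl) le_rfl
  have h0 : RebuildInv p A R E K D (s.nat 5 1) (s.nat 5 2) (s.nat 5 0) (s.prepare 1 5 d) :=
    ⟨h.prepare _ _, by simp only [Store.prepare_smp, if_true]; congr 1; ext j; exact h.D_eq j,
      rfl, rfl, rfl⟩
  refine Runs.seqE (Q₁ := fun s' => s' = s.prepare 1 5 d) ?_ fun s₁ h₁ => ?_
  · have := Runs.prep (k := 1) (a := 5) (m := .get 0 (.lit 1)) (s := s)
      (Q := fun s' => s' = s.prepare 1 5 d) (by simp [NExp.eval, h.static.d_eq])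
    simpa [NExp.eval, h.static.d_eq] using this
  subst h₁
  refine Runs.seqE (runs_findM h0 hM hM') fun s₂ ⟨h₂, y₂⟩ => ?_
  refine RunsE.setN_seq ?_
  have hJ2 : (drawCount p).eval s₂ = J := by
    refine hJ s₂ ?_
    rwa [h₂.J_eq, h₂.c_eq]
  -- After `k` of `J` draws the target has moved by the fraction k/J of `b`; the factor exp(-γk)
  -- offsets the growth allowed so far.
  set F : ℕ → Store → ℝ≥0∞ := fun k s' => ENNReal.ofReal (Real.exp (-(γ * k)) *
    coshSum l fun i => s'.real 4 i - a i - k * (b i / J)) with hF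
  refine RunsE.seq (RunsE.forLoop (t := 1 + t) (N := J)
    (RebuildInv p A R E K D m J) F ?_ ?_ ?_ ?_) fun s₃ h₃ => ?_
  · obtain ⟨h1, h2, h3, h4, h5⟩ := h₂
    exact ⟨(h1.putN _ _ (by simp)).putN _ _ (by simp), h2, by simpa [NExp.eval],
      by simp [NExp.eval, hJ2], by simp⟩
  · have y : ∀ i, s₂.real 4 i = s.real 4 i := y₂
    simp [hF, y]
  · intro k s' h'
    exact ⟨h'.c_eq, by simp [NExp.eval, h'.J_eq]⟩
  · intro k hkJ s' h'
    have h1 : RebuildInv p A R E K D m J (k + 1) (s'.putN 5 0 (k + 1)) := by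
      obtain ⟨h1, h2, h3, h4, h5⟩ := h'
      exact ⟨h1.putN _ _ (by simp), h2, by simpa, by simpa, by simp⟩
    have h2 := hk _ _ h1 fun y => Real.exp (-(γ * (k + 1 : ℕ))) *
      coshSum l fun i => y i - a i - (k + 1 : ℕ) * (b i / J)
    refine RunsE.setN_seq ?_
    have h3 : NExp.eval s' (.add (.get 5 (.lit 0)) (.lit 1)) = k + 1 := by
      simp [NExp.eval, h'.c_eq]
    rw [h3]
    refine h2.mono le_rfl (fun _ h => h) (fun _ _ => le_rfl) ?_
    have h4 : ∀ v, (ENNReal.ofReal (Real.exp (-(γ * (k + 1 : ℕ))) * coshSum l fun i =>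
        (s'.putN 5 0 (k + 1)).real 4 i + f v i - a i - (k + 1 : ℕ) * (b i / J))) =
        ENNReal.ofReal (Real.exp (-(γ * (k + 1 : ℕ)))) * ENNReal.ofReal (coshSum l fun i =>
          (s'.real 4 i - a i - k * (b i / J)) + f v i - b i / J) := by
      intro v
      rw [ENNReal.ofReal_mul (Real.exp_pos _).le]
      congr 3
      ext i
      push_cast
      rw [Store.putN_real]
      ring
    simp only [h4]
    rw [expect_const_mul]
    refine (mul_le_mul_right (hl _) _).trans ?_
    rw [← ENNReal.ofReal_mul (Real.exp_pos _).le, ← mul_assoc, ← Real.exp_add]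
    refine le_of_eq ?_
    simp only [hF]
    congr 3
    push_cast
    ring
  · refine (runs_clearD hp h₃.inv).toRunsE (fun s' h' => ?_) |>.mono le_rfl (fun _ h => h.1)
      (fun _ _ => le_rfl) le_rfl
    have : (J : ℝ) ≠ 0 := by exact_mod_cast hJ0
    simp [hF, h'.2, mul_div_cancel₀ _ this]

end

/-! ### Norms -/

section

variable {p n d : ℕ}

theorem fact_one_le (hp : p ≠ 0) : Fact ((1 : ℝ≥0∞) ≤ (p : ℝ≥0∞)) :=
  ⟨by exact_mod_cast Nat.one_le_iff_ne_zero.2 hp⟩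

theorem lpNorm_nonneg (hp : p ≠ 0) (v : Fin d → ℝ) : 0 ≤ lpNorm p v :=
  haveI := fact_one_le hp
  norm_nonneg _

theorem lpNorm_zero (hp : p ≠ 0) : lpNorm p (0 : Fin d → ℝ) = 0 :=
  haveI := fact_one_le hp
  norm_zero

theorem lpNorm_add_le (hp : p ≠ 0) (v w : Fin d → ℝ) :
    lpNorm p (v + w) ≤ lpNorm p v + lpNorm p w :=
  haveI := fact_one_le hp
  norm_add_le _ _

theorem lpNorm_smul (hp : p ≠ 0) (c : ℝ) (v : Fin d → ℝ) :
    lpNorm p (c • v) = |c| * lpNorm p v :=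
  haveI := fact_one_le hp
  norm_smul c (WithLp.toLp (p : ℝ≥0∞) v)

theorem abs_apply_le_lpNorm (hp : p ≠ 0) (v : Fin d → ℝ) (j : Fin d) : |v j| ≤ lpNorm p v :=
  haveI := fact_one_le hp
  PiLp.norm_apply_le (WithLp.toLp (p : ℝ≥0∞) v) j

theorem eq_zero_of_lpNorm_eq_zero (hp : p ≠ 0) {v : Fin d → ℝ} (h : lpNorm p v = 0) : v = 0 := by
  ext j
  exact abs_nonpos_iff.1 (h ▸ abs_apply_le_lpNorm hp v j)

theorem powSum_nonneg (p : ℕ) (v : Fin d → ℝ) : 0 ≤ powSum p v :=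
  Finset.sum_nonneg fun _ _ => by positivity

theorem lpNorm_pow (hp : p ≠ 0) (v : Fin d → ℝ) : lpNorm p v ^ p = powSum p v := by
  have := fact_one_le hp
  rw [lpNorm, PiLp.norm_eq_of_nat p rfl, one_div,
    Real.rpow_inv_natCast_pow (Finset.sum_nonneg fun _ _ => by positivity) hp]
  rfl

theorem abs_mulVec_le (hp : p ≠ 0) {A : Matrix (Fin n) (Fin d) ℝ} (hA : opNormToInf p A ≤ 1)
    (v : Fin d → ℝ) (i : Fin n) : |A.mulVec v i| ≤ lpNorm p v := by
  -- The real supremum of an unbounded set is 0 by convention, so `hA` is informative only together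
  -- with boundedness.
  have hbdd : BddAbove {r : ℝ | ∃ v : Fin d → ℝ, lpNorm p v = 1 ∧ r = ‖A.mulVec v‖} := by
    refine ⟨∑ i, ∑ j, |A i j|, ?_⟩
    rintro _ ⟨v, hv, rfl⟩
    refine (pi_norm_le_iff_of_nonneg (Finset.sum_nonneg fun i _ => Finset.sum_nonneg fun j _ =>
      abs_nonneg _)).2 fun i => ?_
    refine le_trans ?_ (Finset.single_le_sum (f := fun i => ∑ j, |A i j|)
      (fun i _ => Finset.sum_nonneg fun j _ => abs_nonneg _) (Finset.mem_univ i))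
    rw [Real.norm_eq_abs, Matrix.mulVec, dotProduct]
    refine (Finset.abs_sum_le_sum_abs _ _).trans (Finset.sum_le_sum fun j _ => ?_)
    rw [abs_mul]
    exact mul_le_of_le_one_right (abs_nonneg _) (hv ▸ abs_apply_le_lpNorm hp v j)
  by_cases h0 : lpNorm p v = 0
  · rw [eq_zero_of_lpNorm_eq_zero hp h0, lpNorm_zero hp]
    simp
  · have hpos : 0 < lpNorm p v := lt_of_le_of_ne (lpNorm_nonneg hp v) (Ne.symm h0)
    have h1 : lpNorm p ((lpNorm p v)⁻¹ • v) = 1 := by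
      rw [lpNorm_smul hp, abs_of_pos (inv_pos.2 hpos), inv_mul_cancel₀ h0]
    have h2 := (le_csSup hbdd ⟨_, h1, rfl⟩).trans hA
    have h3 := (norm_le_pi_norm _ i).trans h2
    rw [Matrix.mulVec_smul, Pi.smul_apply, norm_smul, Real.norm_eq_abs, Real.norm_eq_abs,
      abs_of_pos (inv_pos.2 hpos), inv_mul_le_iff₀ hpos, mul_one] at h3
    exact h3

/-- Test `A` on the standard basis vectors. -/
theorem abs_entry_le {A : Matrix (Fin n) (Fin d) ℝ} (hA : opNormToInf 1 A ≤ 1) (i : Fin n)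
    (j : Fin d) : |A i j| ≤ 1 := by
  have h := abs_mulVec_le one_ne_zero hA (Pi.single j 1) i
  have h1 := lpNorm_pow one_ne_zero (Pi.single j 1 : Fin d → ℝ)
  rw [pow_one] at h1
  rw [h1] at h
  simpa [powSum, Pi.single_apply, apply_ite] using h

/-- Testing `A` on one of its own rows a gives ‖a‖₂² ≤ ‖a‖₂, so each row contributes at most 1. -/
theorem frobSq_le {A : Matrix (Fin n) (Fin d) ℝ} (hA : opNormToInf 2 A ≤ 1) : frobSq A ≤ n := by
  have : ∀ i, ∑ j, A i j ^ 2 ≤ 1 := by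
    intro i
    have h := abs_mulVec_le two_ne_zero hA (A i) i
    have h1 := lpNorm_pow two_ne_zero (A i)
    have h2 : A.mulVec (A i) i = powSum 2 (A i) := by
      simp [Matrix.mulVec, dotProduct, powSum, pow_two]
    have h4 : ∑ j, A i j ^ 2 = powSum 2 (A i) := by simp [powSum]
    rw [h2, abs_of_nonneg (powSum_nonneg _ _), ← h1] at h
    have h3 := lpNorm_nonneg two_ne_zero (A i)
    rw [h4, ← h1]
    nlinarith
  refine (Finset.sum_le_sum fun i _ => this i).trans ?_
  simp

/-! ### The growth of the potential in one draw -/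

variable {A : Matrix (Fin n) (Fin d) ℝ} {D : Fin d → ℝ} {J : ℕ} {l γ θ : ℝ}

theorem expect_sampleLaw_coshSum_le {m : ℕ} {w : ℕ → ℝ} {f : ℕ → Fin n → ℝ} {l b v γ : ℝ}
    {μ : Fin n → ℝ} (hw : ∑ j ∈ Finset.range m, |w j| ≠ 0)
    (hf : ∀ i, ∀ q < m, |l * f q i| ≤ 1)
    (hb : ∀ i, |∑ q ∈ Finset.range m, |w q| / (∑ j ∈ Finset.range m, |w j|) * f q i - μ i| ≤ b)
    (hv : ∀ i, ∑ q ∈ Finset.range m, |w q| / (∑ j ∈ Finset.range m, |w j|) * f q i ^ 2 ≤ v)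
    (hγ : |l| * b + l ^ 2 * v ≤ γ) (e : Fin n → ℝ) :
    expect (sampleLaw m w) (fun q => ENNReal.ofReal (coshSum l fun i => e i + f q i - μ i)) ≤
      ENNReal.ofReal (Real.exp γ * coshSum l e) := by
  rw [expect_sampleLaw hw fun q => coshSum_nonneg _ _]
  refine ENNReal.ofReal_le_ofReal (sum_coshSum_le (fun q _ => ?_) ?_
    (fun i q hq => hf i q (Finset.mem_range.1 hq)) hb hv hγ e)
  · exact div_nonneg (abs_nonneg _) (Finset.sum_nonneg fun _ _ => abs_nonneg _)
  · rw [← Finset.sum_div, div_self hw]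

/-- The sign of D_j and the factor ‖D‖₁/J make the sampled column exactly unbiased for A D / J. As
the entries of `A` are at most 1, a coordinate changes by at most ‖D‖₁/J, which also bounds the
second moment. -/
theorem expect_changeOne_le (hA : ∀ i j, |A i j| ≤ 1) (hD : powSum 1 D ≠ 0)
    (h1 : |l| * (powSum 1 D / J) ≤ 1) (h2 : l ^ 2 * (powSum 1 D / J) ^ 2 ≤ γ) (e : Fin n → ℝ) :
    expect (sampleLaw d (extend D)) (fun v => ENNReal.ofReal (coshSum l fun i =>
      e i + changeOne A D J v i - A.mulVec D i / J)) ≤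
        ENNReal.ofReal (Real.exp γ * coshSum l e) := by
  have hW : ∑ j ∈ Finset.range d, |extend D j| = powSum 1 D := by
    rw [Finset.sum_range]
    simp [powSum]
  have hS := powSum_nonneg 1 D
  have hext : ∀ i v, |extend (A i) v| ≤ 1 := by
    intro i v
    rw [extend]
    split_ifs
    · exact hA _ _
    · simp
  have habs : ∀ i v, |changeOne A D J v i| ≤ powSum 1 D / J := by
    intro i v
    have hn : 0 ≤ powSum 1 D / J := div_nonneg hS (Nat.cast_nonneg _)
    rw [changeOne, abs_mul]
    have : |if 0 ≤ extend D v then powSum 1 D / J else -(powSum 1 D / J)| = powSum 1 D / J := by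
      split_ifs
      · exact abs_of_nonneg hn
      · rw [abs_neg, abs_of_nonneg hn]
    rw [this]
    exact mul_le_of_le_one_right hn (hext i v)
  refine expect_sampleLaw_coshSum_le (b := 0) (v := (powSum 1 D / J) ^ 2) (by rwa [hW])
    (fun i q _ => ?_) (fun i => ?_) (fun i => ?_) (by simpa using h2) e
  · rw [abs_mul]
    exact (mul_le_mul_of_nonneg_left (habs i q) (abs_nonneg l)).trans h1
  · rw [hW, Finset.sum_range, Matrix.mulVec, dotProduct, Finset.sum_div, ← Finset.sum_sub_distrib]
    refine (abs_nonpos_iff.2 (Finset.sum_eq_zero fun j _ => ?_))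
    simp only [changeOne, extend_val]
    rcases le_or_gt 0 (D j) with h | h
    · rw [if_pos h, abs_of_nonneg h]
      field_simp
      ring
    · rw [if_neg h.not_ge, abs_of_neg h]
      field_simp
      ring
  · rw [hW]
    calc _ ≤ ∑ q ∈ Finset.range d, |extend D q| / powSum 1 D * (powSum 1 D / J) ^ 2 := by
          refine Finset.sum_le_sum fun q _ => mul_le_mul_of_nonneg_left ?_
            (div_nonneg (abs_nonneg _) hS)
          rw [← sq_abs]
          exact pow_le_pow_left₀ (abs_nonneg _) (habs i q) 2
      _ = _ := by rw [← Finset.sum_mul, ← Finset.sum_div, hW, div_self hD, one_mul]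

theorem frobSq_eq_zero (h : frobSq A = 0) : A = 0 := by
  have h1 := (Finset.sum_eq_zero_iff_of_nonneg fun i _ => Finset.sum_nonneg fun j _ =>
    sq_nonneg (A i j)).1 h
  ext i j
  have h2 := (Finset.sum_eq_zero_iff_of_nonneg fun j _ => sq_nonneg (A i j)).1
    (h1 i (Finset.mem_univ i)) j (Finset.mem_univ j)
  simpa using h2

/-- The untruncated estimate z, equal to ‖A‖_F² D_j/A_ij in the drawn row and 0 in the others, has
mean A D, and its second moment in a row is at most ‖A‖_F² ‖D‖₂² ≤ n‖D‖₂². Tiny entries make z huge,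
hence the cut-off at `θ`: it gives the sure bound `h1`, and the bias it causes is at most E z²/θ
before division by `J`. This bias is the first term in `h2`. -/
theorem expect_changeTwo_le (hA : frobSq A ≤ n) (hθ : 0 < θ) (hJ : 0 < J)
    (h1 : |l| * (θ / J) ≤ 1)
    (h2 : |l| * (n * powSum 2 D / (θ * J)) + l ^ 2 * (n * powSum 2 D / J ^ 2) ≤ γ)
    (e : Fin n → ℝ) :
    expect (sampleLaw (matSupport A).length fun q => valAt A q ^ 2) (fun v =>
      ENNReal.ofReal (coshSum l fun i => e i + changeTwo A D θ J v i - A.mulVec D i / J)) ≤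
        ENNReal.ofReal (Real.exp γ * coshSum l e) := by
  have hJ' : (0 : ℝ) < J := by exact_mod_cast hJ
  have hS := powSum_nonneg 2 D
  have hW : ∑ q ∈ Finset.range (matSupport A).length, |valAt A q ^ 2| = frobSq A := by
    simp only [abs_sq]
    exact sum_matSupport A (fun _ _ x => x ^ 2) (by simp)
  -- If `A` is zero, the sampler is concentrated at 0 and the estimate vanishes, as does A D.
  by_cases hF : frobSq A = 0
  · rw [sampleLaw_of_sum_eq_zero (by rwa [hW]), expect_pure]
    refine ENNReal.ofReal_le_ofReal ?_
    have h3 : ∀ i, changeTwo A D θ J 0 i = 0 := by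
      intro i
      simp [changeTwo, estimate, hF]
    have hγ : 0 ≤ γ := le_trans (by positivity) h2
    simp only [h3]
    simpa [frobSq_eq_zero hF] using le_mul_of_one_le_left (coshSum_nonneg l e) (Real.one_le_exp hγ)
  have hF0 : 0 ≤ frobSq A := hW ▸ Finset.sum_nonneg fun _ _ => abs_nonneg _
  -- the estimate without truncation
  let z : ℕ → Fin n → ℝ := fun q i => if rowAt A q = i then estimate A D q else 0
  have hmean : ∀ i, ∑ q ∈ Finset.range (matSupport A).length,
      |valAt A q ^ 2| / frobSq A * z q i = A.mulVec D i := by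
    intro i
    have e1 : ∀ q ∈ Finset.range (matSupport A).length, |valAt A q ^ 2| / frobSq A * z q i =
        if rowAt A q = i then valAt A q * extend D (colAt A q) else 0 := by
      intro q hq
      have := valAt_ne_zero A (Finset.mem_range.1 hq)
      simp only [z, estimate, abs_sq]
      split_ifs
      · field_simp
      · rw [mul_zero]
    rw [Finset.sum_congr rfl e1, sum_matSupport A
      (fun r c x => if r = i then x * extend D c else 0) (by simp), Finset.sum_eq_single i]
    · simp [Matrix.mulVec, dotProduct]
    · intro b _ hb
      simp [Fin.val_ne_of_ne hb]
    · simp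
  have hsecond : ∀ i, ∑ q ∈ Finset.range (matSupport A).length,
      |valAt A q ^ 2| / frobSq A * z q i ^ 2 ≤ n * powSum 2 D := by
    intro i
    -- The conjunct `valAt A q ≠ 0` always holds on the list; it is kept so that the summand
    -- vanishes at zero entries, as `sum_matSupport` requires.
    have e1 : ∀ q ∈ Finset.range (matSupport A).length, |valAt A q ^ 2| / frobSq A * z q i ^ 2 =
        if rowAt A q = i ∧ valAt A q ≠ 0 then frobSq A * extend D (colAt A q) ^ 2 else 0 := by
      intro q hq
      have := valAt_ne_zero A (Finset.mem_range.1 hq)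
      simp only [z, estimate, abs_sq, this, ne_eq, not_false_eq_true, and_true]
      split_ifs
      · field_simp
      · simp
    rw [Finset.sum_congr rfl e1, sum_matSupport A
      (fun r c x => if r = i ∧ x ≠ 0 then frobSq A * extend D c ^ 2 else 0) (by simp),
      Finset.sum_eq_single i]
    · calc _ ≤ ∑ j, frobSq A * |D j| ^ 2 := by
            refine Finset.sum_le_sum fun j _ => ?_
            split_ifs
            · simp
            · positivity
        _ = frobSq A * powSum 2 D := by rw [← Finset.mul_sum, powSum]
        _ ≤ _ := mul_le_mul_of_nonneg_right hA hS
    · intro b _ hb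
      simp [Fin.val_ne_of_ne hb]
    · simp
  have hprob : ∀ q, 0 ≤ |valAt A q ^ 2| / frobSq A := fun q => div_nonneg (abs_nonneg _) hF0
  refine expect_sampleLaw_coshSum_le (b := n * powSum 2 D / (θ * J)) (v := n * powSum 2 D / J ^ 2)
    (by rwa [hW]) (fun i q _ => ?_) (fun i => ?_) (fun i => ?_) h2 e
  · rw [abs_mul]
    refine le_trans (mul_le_mul_of_nonneg_left ?_ (abs_nonneg l)) h1
    rw [changeTwo]
    split_ifs with h
    · rw [abs_div, abs_of_pos hJ']
      exact div_le_div_of_nonneg_right h.2 hJ'.le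
    · rw [abs_zero]
      positivity
  · rw [hW, ← hmean i, Finset.sum_div, ← Finset.sum_sub_distrib]
    refine (Finset.abs_sum_le_sum_abs _ _).trans (le_trans (Finset.sum_le_sum (g := fun q =>
      |valAt A q ^ 2| / frobSq A * z q i ^ 2 / (θ * J)) fun q _ => ?_) ?_)
    · rw [mul_div_assoc, ← mul_sub, abs_mul, abs_of_nonneg (hprob q), mul_div_assoc]
      refine mul_le_mul_of_nonneg_left ?_ (hprob q)
      simp only [changeTwo, z]
      by_cases hr : rowAt A q = i
      · by_cases ht : |estimate A D q| ≤ θ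
        · simp only [hr, ht, and_self, if_true, sub_self, abs_zero]
          positivity
        · simp only [hr, ht, and_false, if_false, if_true, zero_sub, abs_neg, abs_div]
          -- A discarded value has |z| > θ, hence |z| ≤ z²/θ.
          rw [abs_of_pos hJ', div_le_div_iff₀ hJ' (by positivity), ← sq_abs (estimate A D q)]
          have := mul_le_mul_of_nonneg_right (mul_le_mul_of_nonneg_left (not_le.1 ht).le
            (abs_nonneg (estimate A D q))) hJ'.le
          linarith
      · simp [hr]
    · rw [← Finset.sum_div]
      exact div_le_div_of_nonneg_right (hsecond i) (by positivity)
  · rw [hW]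
    refine le_trans (Finset.sum_le_sum (g := fun q =>
      |valAt A q ^ 2| / frobSq A * z q i ^ 2 / J ^ 2) fun q _ => ?_) ?_
    · rw [mul_div_assoc]
      refine mul_le_mul_of_nonneg_left ?_ (hprob q)
      simp only [changeTwo, z]
      by_cases hr : rowAt A q = i
      · by_cases ht : |estimate A D q| ≤ θ
        · simp [hr, ht, div_pow]
        · simp only [hr, ht, and_false, if_false, if_true, ne_eq, OfNat.ofNat_ne_zero,
            not_false_eq_true, zero_pow]
          positivity
      · simp [hr]
    · rw [← Finset.sum_div]
      exact div_le_div_of_nonneg_right (hsecond i) (by positivity)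

end

/-! ### The choice of the parameters -/

section

variable {p n d : ℕ} {A : Matrix (Fin n) (Fin d) ℝ} {R ε : ℝ} {K L : ℕ} {D : Fin d → ℝ} {s : Store}

/-- The number of parts into which a collected update is split. -/
noncomputable def parts (p : ℕ) {d : ℕ} (ε : ℝ) (D : Fin d → ℝ) : ℕ := ⌈lpNorm p D / (ε / 2)⌉₊

theorem pow_mul_lt_powSum (hp : p ≠ 0) (hε : 0 < ε) {k : ℕ} (hk : k < parts p ε D) :
    k ^ p * (ε / 2) ^ p < powSum p D := by
  rw [parts, Nat.lt_ceil, lt_div_iff₀ (by positivity)] at hk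
  rw [← mul_pow, ← lpNorm_pow hp]
  exact pow_lt_pow_left₀ hk (by positivity) hp

theorem powSum_le_pow_mul (hp : p ≠ 0) (hε : 0 < ε) :
    powSum p D ≤ (parts p ε D) ^ p * (ε / 2) ^ p := by
  have := Nat.le_ceil (lpNorm p D / (ε / 2))
  rw [div_le_iff₀ (by positivity)] at this
  rw [← mul_pow, ← lpNorm_pow hp]
  exact pow_le_pow_left₀ (lpNorm_nonneg hp D) this p

theorem le_lpNorm_of_pow_le (hp : p ≠ 0) (hD : (ε / 2) ^ p ≤ powSum p D) : ε / 2 ≤ lpNorm p D := by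
  rw [← lpNorm_pow hp] at hD
  exact le_of_pow_le_pow_left₀ hp (lpNorm_nonneg hp D) hD

theorem lpNorm_lt_of_lt_pow (hp : p ≠ 0) (hε : 0 < ε) (hD : powSum p D < (ε / 2) ^ p) :
    lpNorm p D < ε / 2 := by
  rw [← lpNorm_pow hp] at hD
  exact lt_of_pow_lt_pow_left₀ p (by positivity) hD

theorem parts_pos (hε : 0 < ε) (h : ε / 2 ≤ lpNorm p D) : 0 < parts p ε D :=
  Nat.ceil_pos.2 (div_pos (lt_of_lt_of_le (by positivity) h) (by positivity))

/-- Rounding up a number that is at least 1 less than doubles it or doubles it at most. -/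
theorem parts_mul_le (hε : 0 < ε) (h : ε / 2 ≤ lpNorm p D) :
    parts p ε D * (ε / 2) ≤ 2 * lpNorm p D := by
  have h1 : 0 < ε / 2 := by positivity
  have h2 := Nat.ceil_lt_add_one (div_nonneg (h1.le.trans h) h1.le)
  rw [← parts] at h2
  have h3 := mul_lt_mul_of_pos_right h2 h1
  rw [add_mul, div_mul_cancel₀ _ h1.ne', one_mul] at h3
  linarith

/-- This fixes the constants, with l = 8L/ε and Kε ≥ 64RL. For p = 1 there are J = mK draws, each
moving a coordinate by at most ε/(2K), and l²(ε/2K)² = 16L²/K² is at most γ = Lε/(2RK). For p = 2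
there are J = nmK draws and θ = 8Rmn. Then lθ/J = 64RL/(Kε) ≤ 1, and the bias and the variance each
use at most half of γ = Lε/(2RnK); both estimates need the full constant 64. In both cases γJ =
(Lε/2R) m. -/
theorem runs_rebuild_parts (hp : p = 1 ∨ p = 2) (hn : 0 < n) (hA : opNormToInf p A ≤ 1)
    (hε : 0 < ε) (hεR : ε ≤ R / 2) (hL : 0 < L) (hK : 64 * (R * L) ≤ K * ε)
    (h : Inv p A R ((ε / 2) ^ p) K D s) (hD : (ε / 2) ^ p ≤ powSum p D) (a : Fin n → ℝ) :
    RunsE (rebuild p) s (4 * d + 2 * parts p ε D + 10 * (n * parts p ε D * K) + 9)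
      (Inv p A R ((ε / 2) ^ p) K 0)
      (fun s' => ENNReal.ofReal (Real.exp (-(L * ε / (2 * R) * parts p ε D)) *
        coshSum (8 * L / ε) fun i => s'.real 4 i - a i - A.mulVec D i))
      (ENNReal.ofReal (coshSum (8 * L / ε) fun i => s.real 4 i - a i)) := by
  have hp0 : p ≠ 0 := by omega
  have hm := parts_pos hε (le_lpNorm_of_pow_le hp0 hD)
  have hM' := powSum_le_pow_mul (D := D) hp0 hε
  have hM := fun k hk => pow_mul_lt_powSum (D := D) (k := k) hp0 hε hk
  set m := parts p ε D with hmdef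
  have hR : 0 < R := by linarith
  have hL' : (1 : ℝ) ≤ L := by exact_mod_cast hL
  have hn' : (0 : ℝ) < n := by exact_mod_cast hn
  have hm' : (0 : ℝ) < m := by exact_mod_cast hm
  have hK0 : (0 : ℝ) < K := by
    by_contra h0
    have h1 : (K : ℝ) * ε ≤ 0 := mul_nonpos_of_nonpos_of_nonneg (not_lt.1 h0) hε.le
    have h2 : 0 < 64 * (R * L) := by positivity
    linarith
  have hK1 : 0 < K := by exact_mod_cast hK0
  have hl : |8 * (L : ℝ) / ε| = 8 * L / ε := abs_of_nonneg (by positivity)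
  rcases hp with rfl | rfl
  · have hS := powSum_nonneg 1 D
    have hS0 : powSum 1 D ≠ 0 := by
      have : 0 < (ε / 2) ^ 1 := by positivity
      linarith
    rw [pow_one, pow_one] at hM'
    have hJ : ((m * K : ℕ) : ℝ) = m * K := by push_cast; ring
    have hSJ : powSum 1 D / (m * K : ℕ) ≤ ε / (2 * K) := by
      rw [hJ, div_le_div_iff₀ (by positivity) (by positivity)]
      nlinarith
    -- From 2ε ≤ R; it makes the exponent 4L/K of a single draw at most 1.
    have hLK : 128 * (L : ℝ) ≤ K := by
      have h1 : 64 * (2 * ε * L) ≤ 64 * (R * L) := by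
        have := mul_le_mul_of_nonneg_right (show 2 * ε ≤ R by linarith) (by positivity : (0 : ℝ) ≤ L)
        linarith
      have h2 : ε * (128 * L) ≤ ε * K := by linarith
      exact le_of_mul_le_mul_left h2 hε
    refine (runs_rebuild (J := m * K) (t := n * 3 + 5) hp0 h hM (by simpa using hM') (fun s' h' => ?_)
      (Nat.mul_pos hm hK1).ne' (sampleLaw d (extend D)) (changeOne A D (m * K))
      (fun c s' h' g => ?_) (l := 8 * L / ε) (γ := L * ε / (2 * R * K)) (a := a)
      (b := A.mulVec D) fun e => ?_).mono ?_ (fun _ h => h) (fun s' _ => le_of_eq ?_) le_rfl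
    · simp [drawCount, NExp.eval, h'.m_eq, h'.inv.static.K_eq]
    · exact runs_kernelOne hS0 h' g
    · refine expect_changeOne_le (abs_entry_le hA) hS0 ?_ ?_ e
      · rw [hl]
        refine (mul_le_mul_of_nonneg_left hSJ (by positivity)).trans ?_
        rw [show 8 * (L : ℝ) / ε * (ε / (2 * K)) = 4 * L / K by field_simp; norm_num]
        rw [div_le_one hK0]
        linarith
      · refine (mul_le_mul_of_nonneg_left (pow_le_pow_left₀ (by positivity) hSJ 2)
          (by positivity)).trans ?_
        rw [show (8 * (L : ℝ) / ε) ^ 2 * (ε / (2 * K)) ^ 2 = 16 * L ^ 2 / K ^ 2 by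
          field_simp; norm_num]
        rw [div_le_div_iff₀ (by positivity) (by positivity)]
        have := mul_le_mul_of_nonneg_left hK (by positivity : (0 : ℝ) ≤ L * K)
        have h3 : 0 ≤ L * K * (R * L) := by positivity
        nlinarith
    · have : 9 + m * K * (n * 3 + 5 + 2) ≤ 9 + m * K * (10 * n) :=
        Nat.add_le_add_left (Nat.mul_le_mul_left _ (by omega)) _
      have e : m * K * (10 * n) = 10 * (n * m * K) := by ring
      omega
    · rw [hJ]
      congr 4
      field_simp
  · have hS := powSum_nonneg 2 D
    have hJ : ((n * (m * K) : ℕ) : ℝ) = n * (m * K) := by push_cast; ring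
    have hJ0 : 0 < n * (m * K) := Nat.mul_pos hn (Nat.mul_pos hm hK1)
    refine (runs_rebuild (J := n * (m * K)) (t := 4) hp0 h hM hM' (fun s' h' => ?_)
      hJ0.ne' (sampleLaw (matSupport A).length fun q => valAt A q ^ 2)
      (changeTwo A D (8 * (R * (m * n))) (n * (m * K)))
      (fun c s' h' g => ?_) (l := 8 * L / ε) (γ := L * ε / (2 * R * (n * K))) (a := a)
      (b := A.mulVec D) fun e => ?_).mono ?_ (fun _ h => h) (fun s' _ => le_of_eq ?_) le_rfl
    · simp [drawCount, NExp.eval, h'.m_eq, h'.inv.static.K_eq, h'.inv.static.n_eq]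
    · exact runs_kernelTwo h' g
    · refine expect_changeTwo_le (frobSq_le hA) (by positivity) hJ0 ?_ ?_ e
      · rw [hl, hJ]
        rw [show 8 * (L : ℝ) / ε * (8 * (R * (m * n)) / (n * (m * K))) = 64 * (R * L) / (K * ε) by
          field_simp; norm_num]
        exact (div_le_one (by positivity)).2 hK
      · rw [hl, hJ]
        have hnS : n * powSum 2 D ≤ n * (m ^ 2 * (ε / 2) ^ 2) :=
          mul_le_mul_of_nonneg_left hM' hn'.le
        have e1 : 8 * (L : ℝ) / ε * (n * powSum 2 D / (8 * (R * (m * n)) * (n * (m * K)))) ≤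
            L * ε / (4 * R * (n * K)) := by
          calc _ ≤ 8 * (L : ℝ) / ε *
                (n * (m ^ 2 * (ε / 2) ^ 2) / (8 * (R * (m * n)) * (n * (m * K)))) := by gcongr
            _ = _ := by field_simp; norm_num
        have e2 : (8 * (L : ℝ) / ε) ^ 2 * (n * powSum 2 D / (n * (m * K)) ^ 2) ≤
            L * ε / (4 * R * (n * K)) := by
          calc _ ≤ (8 * (L : ℝ) / ε) ^ 2 * (n * (m ^ 2 * (ε / 2) ^ 2) / (n * (m * K)) ^ 2) := by
                gcongr
            _ = 16 * L ^ 2 / (n * K ^ 2) := by field_simp; norm_num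
            _ ≤ _ := by
              rw [div_le_div_iff₀ (by positivity) (by positivity)]
              have := mul_le_mul_of_nonneg_left hK (by positivity : (0 : ℝ) ≤ L * K * n)
              linarith
        have e3 : L * ε / (2 * R * (n * K)) =
            L * ε / (4 * R * (n * K)) + L * ε / (4 * R * (n * K)) := by
          field_simp; norm_num
        rw [e3]
        exact add_le_add e1 e2
    · have : n * (m * K) * (4 + 2) ≤ 10 * (n * m * K) := by
        rw [show n * m * K = n * (m * K) by ring]
        omega
      omega
    · rw [hJ]
      congr 4
      field_simp

/-! ### The schedule of rebuilds -/

/-- The sum of the updates since the last rebuild, after `t` updates. -/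
noncomputable def pending (p : ℕ) {d : ℕ} (ε : ℝ) (Δ : ℕ → Fin d → ℝ) : ℕ → Fin d → ℝ
  | 0 => 0
  | t + 1 => if (ε / 2) ^ p ≤ powSum p (pending p ε Δ t + Δ t) then 0 else pending p ε Δ t + Δ t

/-- The number of parts that the update number `t` causes to be processed. -/
noncomputable def work (p : ℕ) {d : ℕ} (ε : ℝ) (Δ : ℕ → Fin d → ℝ) (t : ℕ) : ℕ :=
  if (ε / 2) ^ p ≤ powSum p (pending p ε Δ t + Δ t) then parts p ε (pending p ε Δ t + Δ t) else 0

theorem lpNorm_pending_le (hp : p ≠ 0) (hε : 0 < ε) (Δ : ℕ → Fin d → ℝ) (t : ℕ) :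
    lpNorm p (pending p ε Δ t) ≤ ε / 2 := by
  cases t with
  | zero => rw [pending, lpNorm_zero hp]; positivity
  | succ t =>
    rw [pending]
    split_ifs with h
    · rw [lpNorm_zero hp]; positivity
    · exact (lpNorm_lt_of_lt_pow hp hε (not_le.1 h)).le

/-- Amortization with credit 2‖D‖ for the pending vector D: an update adds at most 2‖Δ‖ of credit,
and a rebuild spends it on its m parts, since m ε/2 ≤ 2‖D‖. -/
theorem sum_work_le (hp : p ≠ 0) (hε : 0 < ε) (Δ : ℕ → Fin d → ℝ) (t : ℕ) :
    (∑ i ∈ Finset.range t, (work p ε Δ i : ℝ)) * (ε / 2) + 2 * lpNorm p (pending p ε Δ t) ≤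
      2 * ∑ i ∈ Finset.range t, lpNorm p (Δ i) := by
  induction t with
  | zero => simp [pending, lpNorm_zero hp]
  | succ t ih =>
    rw [Finset.sum_range_succ, Finset.sum_range_succ, add_mul, pending, work]
    have h1 := lpNorm_add_le hp (pending p ε Δ t) (Δ t)
    split_ifs with h
    · have h2 := parts_mul_le hε (le_lpNorm_of_pow_le hp h)
      rw [lpNorm_zero hp]
      linarith
    · rw [Nat.cast_zero]
      linarith

/-- What the output approximates after `t` updates. -/
noncomputable def processed (p : ℕ) {d : ℕ} (ε : ℝ) (x₀ : Fin d → ℝ) (Δ : ℕ → Fin d → ℝ) (t : ℕ) :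
    Fin d → ℝ :=
  x₀ + ∑ i ∈ Finset.range t, Δ i - pending p ε Δ t

/-- The potential after `t` updates. -/
noncomputable def potential (p : ℕ) {n d : ℕ} (A : Matrix (Fin n) (Fin d) ℝ) (R ε : ℝ) (L : ℕ)
    (x₀ : Fin d → ℝ) (Δ : ℕ → Fin d → ℝ) (t : ℕ) (s : Store) : ℝ :=
  Real.exp (-(L * ε / (2 * R) * ∑ i ∈ Finset.range t, (work p ε Δ i : ℝ))) *
    coshSum (8 * L / ε) fun i => s.real 4 i - A.mulVec (processed p ε x₀ Δ t) i

/-- Without a rebuild the output, the processed vector and the work stay the same, and so does the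
potential. With one, the processed vector grows by the collected update, and the new discount factor
is the one that `runs_rebuild_parts` supplies. -/
theorem runs_queryProg (hp : p = 1 ∨ p = 2) (hn : 0 < n) (hA : opNormToInf p A ≤ 1)
    (hε : 0 < ε) (hεR : ε ≤ R / 2) (hL : 0 < L) (hK : 64 * (R * L) ≤ K * ε) (x₀ : Fin d → ℝ)
    (Δ : ℕ → Fin d → ℝ) (t : ℕ) (h : Inv p A R ((ε / 2) ^ p) K (pending p ε Δ t) s) :
    RunsE (queryProg p) (s.feed (Δ t))
      (13 * nnzVec (Δ t) + work p ε Δ t * (4 * d + 10 * (n * K) + 11))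
      (Inv p A R ((ε / 2) ^ p) K (pending p ε Δ (t + 1)))
      (fun s' => ENNReal.ofReal (potential p A R ε L x₀ Δ (t + 1) s'))
      (ENNReal.ofReal (potential p A R ε L x₀ Δ t s)) := by
  have hp0 : p ≠ 0 := by omega
  have hlen := length_vecSupport_le (Δ t)
  have h1 : 1 ≤ nnzVec (Δ t) := le_max_left _ _
  have hr := runs_readUpdate h (Δ t)
  set D := pending p ε Δ t + Δ t with hDdef
  by_cases hD : (ε / 2) ^ p ≤ powSum p D
  · have hw : work p ε Δ t = parts p ε D := by rw [work, if_pos hD]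
    have hpend : pending p ε Δ (t + 1) = 0 := by rw [pending, if_pos hD]
    have hpos := parts_pos hε (le_lpNorm_of_pow_le hp0 hD)
    have hproc : processed p ε x₀ Δ (t + 1) = processed p ε x₀ Δ t + D := by
      simp only [processed, hpend, Finset.sum_range_succ, hDdef]
      abel
    rw [hpend, hw]
    refine (Runs.seqE (t₂ := 4 * d + 2 * parts p ε D + 10 * (n * parts p ε D * K) + 9 + 1) hr
      fun s₁ ⟨i₁, y₁⟩ => .ite (fun _ => ?_) fun hb => ?_).mono
      ?_ (fun _ h => h) (fun _ _ => le_rfl) le_rfl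
    · have := (runs_rebuild_parts hp hn hA hε hεR hL hK i₁ hD
        (A.mulVec (processed p ε x₀ Δ t))).const_mul (ENNReal.ofReal
          (Real.exp (-(L * ε / (2 * R) * ∑ i ∈ Finset.range t, (work p ε Δ i : ℝ)))))
      refine this.mono le_rfl (fun _ h => h) (fun s' _ => le_of_eq ?_) (le_of_eq ?_)
      · rw [potential, ← ENNReal.ofReal_mul (Real.exp_pos _).le, ← mul_assoc, ← Real.exp_add,
          Finset.sum_range_succ, hw, hproc, Matrix.mulVec_add]
        congr 3
        · ring
        · ext i
          rw [Pi.add_apply]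
          ring
      · rw [potential, ← ENNReal.ofReal_mul (Real.exp_pos _).le]
        simp only [y₁]
    · refine absurd ?_ hb
      simpa [BExp.holds, RExp.eval, NExp.eval, i₁.static.E_eq, i₁.S_eq] using hD
    · obtain ⟨m, hm⟩ : ∃ m, parts p ε D = m + 1 := ⟨_, (Nat.succ_pred_eq_of_pos hpos).symm⟩
      rw [hm]
      ring_nf
      nlinarith [Nat.zero_le (m * d), Nat.zero_le (m * n * K)]
  · have hw : work p ε Δ t = 0 := by rw [work, if_neg hD]
    have hpend : pending p ε Δ (t + 1) = D := by rw [pending, if_neg hD]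
    have hproc : processed p ε x₀ Δ (t + 1) = processed p ε x₀ Δ t := by
      simp only [processed, hpend, Finset.sum_range_succ, hDdef]
      abel
    rw [hpend, hw]
    refine (Runs.seqE (t₂ := 2) hr fun s₁ ⟨i₁, y₁⟩ => .ite (fun hb => ?_) fun _ => ?_).mono
      (by omega) (fun _ h => h) (fun _ _ => le_rfl) le_rfl
    · refine absurd ?_ hD
      simpa [BExp.holds, RExp.eval, NExp.eval, i₁.static.E_eq, i₁.S_eq] using hb
    · refine (Runs.skip (Q := fun s' => s' = s₁) rfl).toRunsE (fun s' h' => ?_) |>.mono le_rfl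
        (fun _ h => ?_) (fun _ _ => le_rfl) le_rfl
      · subst h'
        refine le_of_eq ?_
        simp only [potential, hproc, Finset.sum_range_succ, hw, Nat.cast_zero, add_zero, y₁]
      · rwa [h]

end

/-! ### Failure probability and total running time -/

section

variable {p n d : ℕ} {A : Matrix (Fin n) (Fin d) ℝ} {R ε δ : ℝ} {K L : ℕ} {s : Store}

/-- A large error forces a large potential. -/
theorem exp_le_potential (hp : p ≠ 0) (hA : opNormToInf p A ≤ 1) (hε : 0 < ε) (hR : 0 < R)
    (x₀ : Fin d → ℝ) (Δ : ℕ → Fin d → ℝ) {t : ℕ}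
    (hΔ : ∑ i ∈ Finset.range t, lpNorm p (Δ i) ≤ R)
    (hbad : ε < ‖s.output n - A.mulVec (x₀ + ∑ i ∈ Finset.range t, Δ i)‖) :
    Real.exp (2 * L) ≤ potential p A R ε L x₀ Δ t s := by
  obtain ⟨i, hi⟩ : ∃ i : Fin n, ε < |s.real 4 i - A.mulVec (x₀ + ∑ i ∈ Finset.range t, Δ i) i| := by
    by_contra! h
    exact absurd ((pi_norm_le_iff_of_nonneg hε.le).2 h) (not_le.2 hbad)
  have hx : x₀ + ∑ i ∈ Finset.range t, Δ i = processed p ε x₀ Δ t + pending p ε Δ t := by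
    rw [processed, sub_add_cancel]
  have h1 := (abs_mulVec_le hp hA (pending p ε Δ t) i).trans (lpNorm_pending_le hp hε Δ t)
  -- The pending vector accounts for at most ε/2 of the error; the rest stems from the sampling.
  have h2 : ε / 2 ≤ |s.real 4 i - A.mulVec (processed p ε x₀ Δ t) i| := by
    rw [hx, Matrix.mulVec_add, Pi.add_apply, ← sub_sub] at hi
    have := abs_sub (s.real 4 i - A.mulVec (processed p ε x₀ Δ t) i)
      (A.mulVec (pending p ε Δ t) i)
    linarith
  have h3 := sum_work_le hp hε Δ t
  have h4 := lpNorm_nonneg hp (pending p ε Δ t)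
  -- At most 4R/ε parts have been processed, so the discount is at least exp(-2L), against exp(4L)
  -- from the bad row.
  have hW : L * ε / (2 * R) * ∑ i ∈ Finset.range t, (work p ε Δ i : ℝ) ≤ 2 * L := by
    rw [div_mul_eq_mul_div, div_le_iff₀ (by positivity)]
    have h5 : (∑ i ∈ Finset.range t, (work p ε Δ i : ℝ)) * ε ≤ 4 * R := by linarith
    have := mul_le_mul_of_nonneg_left h5 (Nat.cast_nonneg (α := ℝ) L)
    linarith
  have h6 : Real.exp (4 * L) ≤ coshSum (8 * L / ε) fun i : Fin n =>
      s.real 4 i - A.mulVec (processed p ε x₀ Δ t) i := by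
    refine le_trans (Real.exp_le_exp.2 ?_) (exp_abs_le_coshSum _ i)
    calc (4 * L : ℝ) = 8 * L / ε * (ε / 2) := by field_simp; ring
      _ ≤ _ := mul_le_mul_of_nonneg_left h2 (by positivity)
  calc Real.exp (2 * L) = Real.exp (-(2 * L)) * Real.exp (4 * L) := by
        rw [← Real.exp_add]; ring_nf
    _ ≤ _ := by
        rw [potential]
        gcongr

/-- The error probability. -/
theorem two_mul_le_exp (hε : 0 < ε) (hεR : ε ≤ R / 2) (hL : n * R ≤ 2 ^ L * (ε * δ)) :
    2 * (n : ℝ) ≤ Real.exp (2 * L) * δ := by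
  -- The factor 2 of the initial potential is absorbed by 2ε ≤ R.
  have h1 : n * (2 * ε) ≤ n * R := mul_le_mul_of_nonneg_left (by linarith) (Nat.cast_nonneg n)
  have h2 : ε * (2 * n) ≤ ε * (2 ^ L * δ) := by linarith
  have h3 : 2 * (n : ℝ) ≤ 2 ^ L * δ := le_of_mul_le_mul_left h2 hε
  have h4 : (0 : ℝ) ≤ δ := by
    by_contra h
    have := mul_neg_of_pos_of_neg (show (0 : ℝ) < 2 ^ L by positivity) (not_le.1 h)
    have : (0 : ℝ) ≤ n := Nat.cast_nonneg n
    linarith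
  refine h3.trans (mul_le_mul_of_nonneg_right ?_ h4)
  have h5 : (2 : ℝ) ≤ Real.exp 2 := by have := Real.add_one_le_exp (2 : ℝ); linarith
  calc (2 : ℝ) ^ L ≤ Real.exp 2 ^ L := pow_le_pow_left₀ (by norm_num) h5 L
    _ = Real.exp (2 * L) := by rw [← Real.exp_nat_mul, mul_comm]

theorem half_le_log {x : ℝ} (hx : 2 ≤ x) : 1 / 2 ≤ Real.log x := by
  have h1 := Real.log_two_gt_d9
  have h2 := Real.log_le_log (by norm_num) hx
  linarith

/-- Taking k = L - 1 gives L ≤ 1 + log x / log 2, and x ≥ 2 lets the 1 be absorbed, as 2 / log 2 <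
3. -/
theorem le_three_mul_log {x : ℝ} (hx : 2 ≤ x) (hL : ∀ k < L, (2 : ℝ) ^ k < x) :
    (L : ℝ) ≤ 3 * Real.log x := by
  have h2 := Real.log_two_gt_d9
  have h3 := Real.log_le_log (by norm_num) hx
  cases L with
  | zero => rw [Nat.cast_zero]; linarith
  | succ k =>
    have h4 := Real.log_le_log (by positivity) (hL k (by omega)).le
    rw [Real.log_pow] at h4
    have h5 : (k : ℝ) * 0.69 ≤ k * Real.log 2 :=
      mul_le_mul_of_nonneg_left (by linarith) (Nat.cast_nonneg k)
    push_cast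
    linarith

/-- For p = 2 the time bound has logarithmic factors, on nnz(A) and on d R/ε, that these programs do
not need; being at least 1/2, they are dropped at the price of a constant. -/
theorem half_le_pow (hp : p = 1 ∨ p = 2) {x : ℝ} (hx : 1 / 2 ≤ x) : 1 / 2 ≤ x ^ (p - 1) := by
  rcases hp with rfl | rfl <;> norm_num; linarith

/-- The total time. -/
theorem time_le (hp : p = 1 ∨ p = 2) (hn : 0 < n) (hε : 0 < ε) (hεR : ε ≤ R / 2) (hδ : 0 < δ)
    (hδ1 : δ ≤ 1) (hL0 : 0 < L) (hL : ∀ k < L, 2 ^ k * (ε * δ) < n * R)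
    (hK : ∀ k < K, k * ε < 64 * (R * L)) (Δ : ℕ → Fin d → ℝ) {T : ℕ}
    (hΔ : ∑ i ∈ Finset.range T, lpNorm p (Δ i) ≤ R) :
    ((3 * L + 2 * K + 7 * (matSupport A).length + 7 + ∑ t ∈ Finset.range T,
      (13 * nnzVec (Δ t) + work p ε Δ t * (4 * d + 10 * (n * K) + 11)) : ℕ) : ℝ) ≤
        10000 * timeBound p A R ε δ Δ T := by
  have hp0 : p ≠ 0 := by omega
  have hR : 0 < R := by linarith
  have hn1 : (1 : ℝ) ≤ n := by exact_mod_cast hn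
  have hL1 : (1 : ℝ) ≤ L := by exact_mod_cast hL0
  set ρ := R / ε with hρ
  have hρ2 : 2 ≤ ρ := (le_div_iff₀ hε).2 (by linarith)
  have hN : (n : ℝ) * R / (ε * δ) = n * ρ / δ := by rw [hρ]; field_simp
  have hN2 : 2 ≤ (n : ℝ) * R / (ε * δ) := by
    rw [hN, le_div_iff₀ hδ]
    nlinarith
  have hlog := half_le_log hN2
  have hL3 : (L : ℝ) ≤ 3 * Real.log (n * R / (ε * δ)) :=
    le_three_mul_log hN2 fun k hk => (lt_div_iff₀ (by positivity)).2 (hL k hk)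
  set lg := Real.log (n * R / (ε * δ)) with hlg
  have hK1 : (K : ℝ) ≤ 64 * (ρ * L) + 1 := by
    cases K with
    | zero =>
      rw [Nat.cast_zero]
      positivity
    | succ k =>
      have h1 : (k : ℝ) < 64 * (R * L) / ε := (lt_div_iff₀ hε).2 (hK k (by omega))
      rw [show 64 * (R * L) / ε = 64 * (ρ * L) by rw [hρ]; ring] at h1
      push_cast
      linarith
  have hρL : ρ * L ≤ ρ * (3 * lg) := mul_le_mul_of_nonneg_left hL3 (by linarith)
  have hρlg : 1 ≤ ρ * lg := by nlinarith
  have hK2 : (K : ℝ) ≤ 193 * (ρ * lg) := by linarith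
  have hW : ∑ t ∈ Finset.range T, (work p ε Δ t : ℝ) ≤ 4 * ρ := by
    have h3 := sum_work_le hp0 hε Δ T
    have h4 := lpNorm_nonneg hp0 (pending p ε Δ T)
    rw [hρ, ← mul_div_assoc, le_div_iff₀ hε]
    linarith
  have hu := half_le_pow hp (half_le_log hρ2)
  have hw := half_le_pow hp hlog
  set X := (n : ℝ) * ρ ^ 2 * lg with hX
  have hnρ : 1 ≤ n * (ρ * lg) := by nlinarith
  have hXρ : ρ ≤ X := by
    have := mul_le_mul_of_nonneg_left hnρ (by linarith : 0 ≤ ρ)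
    rw [hX]
    linarith
  have hXK : ρ * lg ≤ X := by
    have h1 : 1 ≤ n * ρ := by nlinarith
    have := mul_le_mul_of_nonneg_left h1 (by linarith : 0 ≤ ρ * lg)
    rw [hX]
    linarith
  have hlgX : lg ≤ X := by nlinarith
  have hd0 : (0 : ℝ) ≤ d := Nat.cast_nonneg d
  -- At most 4ρ parts, with K ≤ 193 ρ lg: 4 · 10 · 193 = 7720, and the remaining 44ρ is absorbed by
  -- 44X.
  have hwork : (∑ t ∈ Finset.range T, (work p ε Δ t : ℝ)) * (4 * d + 10 * (n * K) + 11) ≤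
      16 * (d * ρ) + 7764 * X := by
    have h1 : 4 * (d : ℝ) + 10 * (n * K) + 11 ≤ 4 * d + 10 * (n * (193 * (ρ * lg))) + 11 := by
      gcongr
    calc _ ≤ 4 * ρ * (4 * d + 10 * (n * (193 * (ρ * lg))) + 11) := by gcongr
      _ = 16 * (d * ρ) + 7720 * X + 44 * ρ := by rw [hX]; ring
      _ ≤ _ := by linarith
  have htb : timeBound p A R ε δ Δ T = ∑ t ∈ Finset.range T, (nnzVec (Δ t) : ℝ) +
      ((nnzMat A : ℝ) * Real.log ρ ^ (p - 1) + d * ρ) * lg ^ (p - 1) + X := rfl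
  have hm0 : (0 : ℝ) ≤ nnzMat A := Nat.cast_nonneg _
  have hs0 : 0 ≤ ∑ t ∈ Finset.range T, (nnzVec (Δ t) : ℝ) :=
    Finset.sum_nonneg fun _ _ => Nat.cast_nonneg _
  have hmid : ((nnzMat A : ℝ) * (1 / 2) + d * ρ) * (1 / 2) ≤
      ((nnzMat A : ℝ) * Real.log ρ ^ (p - 1) + d * ρ) * lg ^ (p - 1) := by
    gcongr
  have hdρ : 0 ≤ d * ρ := by positivity
  rw [htb, length_matSupport]
  push_cast
  rw [Finset.sum_add_distrib, ← Finset.mul_sum, ← Finset.sum_mul]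
  linarith

end

end RealRAM

theorem mainTheorem6 (p : ℕ) (hp : p = 1 ∨ p = 2) :
    ∃ (ini qry : Cmd) (C : ℝ), 0 < C ∧
      ∀ (n d : ℕ) (_ : 0 < n) (_ : 0 < d) (A : Matrix (Fin n) (Fin d) ℝ) (x₀ : Fin d → ℝ)
        (R ε δ : ℝ) (_ : opNormToInf p A ≤ 1) (_ : 0 < ε) (_ : ε ≤ R / 2) (_ : 0 < δ) (_ : δ ≤ 1)
        (T : ℕ) (Δ : ℕ → Fin d → ℝ) (_ : ∑ t ∈ Finset.range T, lpNorm p (Δ t) ≤ R),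
        ∃ μ : PMF (Record n),
          Session ini qry (inputStore A x₀ R ε δ) Δ T μ ∧
          (∀ ω ∈ μ.support, (ω.time : ℝ) ≤ C * timeBound p A R ε δ Δ T) ∧
          ENNReal.ofReal (1 - δ) ≤ μ.toOuterMeasure
            {ω | ∀ t : ℕ, 1 ≤ t → t ≤ T →
              ‖ω.out t - A.mulVec (x₀ + ∑ i ∈ Finset.range t, Δ i)‖ ≤ ε} := by
  refine ⟨initProg p, queryProg p, 10000, by norm_num, ?_⟩
  intro n d hn _ A x₀ R ε δ hA hε hεR hδ hδ1 T Δ hΔ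
  have hp0 : p ≠ 0 := by omega
  have hR : 0 < R := by linarith
  have hn1 : (1 : ℝ) ≤ n := by exact_mod_cast hn
  have exL : ∃ L : ℕ, n * R ≤ 2 ^ L * (ε * δ) := by
    obtain ⟨L, hL⟩ := pow_unbounded_of_one_lt (n * R / (ε * δ)) (one_lt_two : (1 : ℝ) < 2)
    exact ⟨L, ((div_lt_iff₀ (by positivity)).1 hL).le⟩
  obtain ⟨L, hL', hL⟩ : ∃ L : ℕ, n * R ≤ 2 ^ L * (ε * δ) ∧
      ∀ k < L, (2 : ℝ) ^ k * (ε * δ) < n * R :=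
    ⟨Nat.find exL, Nat.find_spec exL, fun k hk => not_le.1 (Nat.find_min exL hk)⟩
  have exK : ∃ K : ℕ, 64 * (R * L) ≤ K * ε := by
    obtain ⟨K, hK⟩ := exists_nat_ge (64 * (R * L) / ε)
    exact ⟨K, (div_le_iff₀ hε).1 hK⟩
  obtain ⟨K, hK', hK⟩ : ∃ K : ℕ, 64 * (R * L) ≤ K * ε ∧ ∀ k < K, k * ε < 64 * (R * L) :=
    ⟨Nat.find exK, Nat.find_spec exK, fun k hk => not_le.1 (Nat.find_min exK hk)⟩
  -- L = 0 would mean nR ≤ εδ ≤ ε ≤ R/2.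
  have hL0 : 0 < L := by
    rcases Nat.eq_zero_or_pos L with rfl | h
    · have h1 : ε * δ ≤ ε := mul_le_of_le_one_right hε.le hδ1
      rw [pow_zero, one_mul] at hL'
      nlinarith
    · exact h
  have hpart : ∀ t ≤ T, ∑ i ∈ Finset.range t, lpNorm p (Δ i) ≤ R := fun t ht =>
    (Finset.sum_le_sum_of_subset_of_nonneg (Finset.range_subset_range.2 ht)
      fun i _ _ => lpNorm_nonneg hp0 _).trans hΔ
  obtain ⟨μ, hμ, htime, hbad⟩ := Session.exists_of_potential (n := n) (T := T)
    (J := fun t => Inv p A R ((ε / 2) ^ p) K (pending p ε Δ t))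
    (G := fun t s => ENNReal.ofReal (potential p A R ε L x₀ Δ t s))
    (B := ENNReal.ofReal (2 * n)) (H := ENNReal.ofReal (Real.exp (2 * L)))
    (bad := fun t y => ε < ‖y - A.mulVec (x₀ + ∑ i ∈ Finset.range t, Δ i)‖)
    ((runs_initProg (x₀ := x₀) hp0 hL hL' hK hK').toRunsE (fun s hs => le_of_eq (by
      -- The output starts as the exact product A x₀, so the potential starts at 2n.
      have h0 : (fun i : Fin n => s.real 4 i - A.mulVec (processed p ε x₀ Δ 0) i) = 0 := by
        ext i
        simp [hs.2 i, processed, pending]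
      rw [potential, h0, coshSum_zero]
      simp)) |>.mono le_rfl (fun s hs => hs.1) (fun _ _ => le_rfl) le_rfl)
    (fun t _ s hs => runs_queryProg hp hn hA hε hεR hL0 hK' x₀ Δ t hs)
    (fun t ht s _ hb => ENNReal.ofReal_le_ofReal
      (exp_le_potential hp0 hA hε hR x₀ Δ (hpart (t + 1) ht) hb))
  refine ⟨μ, hμ, fun ω hω => ?_, ?_⟩
  · exact (Nat.cast_le.2 (htime ω hω)).trans (time_le hp hn hε hεR hδ hδ1 hL0 hL hK Δ hΔ)
  · refine one_sub_le_toOuterMeasure μ (fun ω => ?_) hδ.le ?_ ENNReal.ofReal_ne_top hbad ?_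
    · by_cases h : ω ∈ {ω : Record n | ∀ t : ℕ, 1 ≤ t → t ≤ T →
        ‖ω.out t - A.mulVec (x₀ + ∑ i ∈ Finset.range t, Δ i)‖ ≤ ε}
      · exact Or.inl h
      · right
        simp only [Set.mem_ofPred_eq, not_forall, not_le] at h
        obtain ⟨t, h1, h2, h3⟩ := h
        exact ⟨t, h1, h2, h3⟩
    · exact (ENNReal.ofReal_pos.2 (Real.exp_pos _)).ne'
    · rw [← ENNReal.ofReal_mul (Real.exp_pos _).le]
      exact ENNReal.ofReal_le_ofReal (two_mul_le_exp hε hεR hL')
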